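/- **Theorem.** Let $0\le k\le n$ be integers. Let $\mathrm{St}(n,k)=\{Q\in\mathbb R^{n\times k}: Q^TQ=I_k\}$, let $\mathrm{Sym}^+(k)$ be the open set of positive definite matrices in the vector space of real symmetric $k\times k$ matrices, let $\mathrm{Sym}(n,k)$ be the set of real symmetric positive semidefinite $n\times n$ matrices of rank $k$, and let $\mathrm{Gr}(k,n)$ be the set of $k$-dimensional linear subspaces of $\mathbb R^n$, with $\pi_G:\mathrm{St}(n,k)\to\mathrm{Gr}(k,n)$, $\pi_G(Q)=\mathrm{span}(Q)$ (the column space). Let $$M(n,k)=\mathrm{St}(n,k)\times_{O(k)}\mathrm{Sym}^+(k)=\bigl(\mathrm{St}(n,k)\times\mathrm{Sym}^+(k)\bigr)/O(k)$$ be the quotient by the action $(Q,S)\cdot G=(QG,\,G^TSG)$ of the orthogonal group $O(k)$, and write $[Q,S]$ for the class of $(Q,S)$. Put $\pi_M([Q,S])=\mathrm{span}(Q)$ and $\pi_{\mathrm{Sym}}(\Sigma)=\mathrm{Im}(\Sigma)$. These spaces carry their standard smooth structures: $\mathrm{St}(n,k)$ and $\mathrm{Sym}(n,k)$ are embedded submanifolds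 of $\mathbb R^{n\times k}$ and $\mathbb R^{n\times n}$, while $\mathrm{Gr}(k,n)$ and $M(n,k)$, with the quotient topologies, are smooth manifolds such that $\pi_G$ and the quotient map $\mathrm{St}(n,k)\times\mathrm{Sym}^+(k)\to M(n,k)$ are smooth submersions. With respect to these structures: 1. $\pi_M:M(n,k)\to\mathrm{Gr}(k,n)$ and $\pi_{\mathrm{Sym}}:\mathrm{Sym}(n,k)\to\mathrm{Gr}(k,n)$ are smooth fiber bundles with model fiber $\mathrm{Sym}^+(k)$ (smooth surjections that are smoothly locally trivial), and $$\phi:M(n,k)\to\mathrm{Sym}(n,k),\qquad \phi([Q,S])=QSQ^T,$$ is a well-defined diffeomorphism with $\pi_{\mathrm{Sym}}\circ\phi=\pi_M$, that is, an isomorphism of fiber bundles over $\mathrm{Gr}(k,n)$. 2. For every $P\in\mathrm{Gr}(k,n)$ the fibers $\pi_M^{-1}(P)\subset M(n,k)$ and $\pi_{\mathrm{Sym}}^{-1}(P)\subset\mathrm{Sym}(n,k)$ are embedded submanifolds diffeomorphic to $\mathrm{Sym}^+(k)$. -/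

import Mathlib

open scoped Manifold ContDiff Matrix

/-- The entrywise maximum norm on real matrices, with the usual topology of the space of matrices.
All norms on this finite-dimensional space define the same topology and the same smooth maps, and
only these are used. -/
noncomputable instance matrixNormedAddCommGroup (n k : ℕ) :
    NormedAddCommGroup (Matrix (Fin n) (Fin k) ℝ) :=
  { Matrix.normedAddCommGroup with
    toMetricSpace := @MetricSpace.replaceUniformity _ (Matrix.instUniformSpace (Fin n) (Fin k) ℝ)
      (Matrix.normedAddCommGroup (m := Fin n) (n := Fin k) (α := ℝ)).toMetricSpace rfl }

noncomputable instance matrixNormedSpace (n k : ℕ) :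
    NormedSpace ℝ (Matrix (Fin n) (Fin k) ℝ) where
  norm_smul_le :=
    (Matrix.normedSpace (m := Fin n) (n := Fin k) (α := ℝ) (R := ℝ)).norm_smul_le

/-- `IsSmoothManifold d X`: the given atlas, modelled on `ℝ^d`, makes `X` a smooth manifold
(Hausdorff, second countable, without boundary) of dimension `d`. -/
structure IsSmoothManifold (d : ℕ) (X : Type*) [TopologicalSpace X]
    [ChartedSpace (EuclideanSpace ℝ (Fin d)) X] : Prop where
  t2 : T2Space X
  secondCountable : SecondCountableTopology X
  isManifold : IsManifold (𝓡 d) ∞ X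

/-- `IsEmbeddedSubmanifold d I S`: with the given atlas and the subspace topology, the subset `S`
of the manifold `X` (with model `I`) is an embedded `d`-dimensional smooth submanifold of `X`. -/
structure IsEmbeddedSubmanifold (d : ℕ) {E H X : Type*} [NormedAddCommGroup E] [NormedSpace ℝ E]
    [TopologicalSpace H] (I : ModelWithCorners ℝ E H) [TopologicalSpace X] [ChartedSpace H X]
    (S : Set X) [ChartedSpace (EuclideanSpace ℝ (Fin d)) S] : Prop where
  manifold : IsSmoothManifold d S
  embedding : Manifold.IsSmoothEmbedding (𝓡 d) I ∞ (Subtype.val : S → X)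

/-- The subset `S` of the manifold `X` is an embedded submanifold which is diffeomorphic to the
manifold `F` (with model `J`). The second component is a statement about every atlas that makes
`S` an embedded submanifold (any two such atlases are equivalent). -/
def IsSubmanifoldDiffeomorphicTo {E H X : Type*} [NormedAddCommGroup E] [NormedSpace ℝ E]
    [TopologicalSpace H] (I : ModelWithCorners ℝ E H) [TopologicalSpace X] [ChartedSpace H X]
    (S : Set X)
    {E' H' : Type*} [NormedAddCommGroup E'] [NormedSpace ℝ E'] [TopologicalSpace H']
    (J : ModelWithCorners ℝ E' H') (F : Type*) [TopologicalSpace F] [ChartedSpace H' F] : Prop :=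
  (∃ (d : ℕ) (_ : ChartedSpace (EuclideanSpace ℝ (Fin d)) S), IsEmbeddedSubmanifold d I S) ∧
  ∀ (d : ℕ) [ChartedSpace (EuclideanSpace ℝ (Fin d)) S], IsEmbeddedSubmanifold d I S →
    Nonempty (S ≃ₘ^∞⟮𝓡 d, J⟯ F)

/-- `π : E → B` is a smooth fiber bundle with model fiber `F`: a smooth surjection such that every
point of `B` has an open neighbourhood `U` (the `baseSet` of `e`) with a diffeomorphism
`π ⁻¹' U → U × F` over `U`. -/
structure IsSmoothFiberBundle {V₁ H₁ V₂ H₂ V₃ H₃ : Type*}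
    [NormedAddCommGroup V₁] [NormedSpace ℝ V₁] [TopologicalSpace H₁]
    [NormedAddCommGroup V₂] [NormedSpace ℝ V₂] [TopologicalSpace H₂]
    [NormedAddCommGroup V₃] [NormedSpace ℝ V₃] [TopologicalSpace H₃]
    (IE : ModelWithCorners ℝ V₁ H₁) (IB : ModelWithCorners ℝ V₂ H₂) (IF : ModelWithCorners ℝ V₃ H₃)
    {E B : Type*} (F : Type*)
    [TopologicalSpace E] [ChartedSpace H₁ E] [TopologicalSpace B] [ChartedSpace H₂ B]
    [TopologicalSpace F] [ChartedSpace H₃ F] (π : E → B) : Prop where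
  smooth : ContMDiff IE IB ∞ π
  surjective : Function.Surjective π
  locallyTrivial : ∀ b : B, ∃ e : Bundle.Trivialization F π, b ∈ e.baseSet ∧
    ContMDiffOn IE (IB.prod IF) ∞ e e.source ∧
    ContMDiffOn (IB.prod IF) IE ∞ e.toOpenPartialHomeomorph.symm e.target

/-- `Φ` is a bundle isomorphism from `π₁ : E₁ → B` to `π₂ : E₂ → B`: both are smooth fiber bundles
with model fiber `F`, and the diffeomorphism `Φ` respects the projections. -/
structure IsSmoothBundleIso {V₁ H₁ V₁' H₁' V₂ H₂ V₃ H₃ : Type*}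
    [NormedAddCommGroup V₁] [NormedSpace ℝ V₁] [TopologicalSpace H₁]
    [NormedAddCommGroup V₁'] [NormedSpace ℝ V₁'] [TopologicalSpace H₁']
    [NormedAddCommGroup V₂] [NormedSpace ℝ V₂] [TopologicalSpace H₂]
    [NormedAddCommGroup V₃] [NormedSpace ℝ V₃] [TopologicalSpace H₃]
    {I₁ : ModelWithCorners ℝ V₁ H₁} {I₂ : ModelWithCorners ℝ V₁' H₁'}
    (IB : ModelWithCorners ℝ V₂ H₂) (IF : ModelWithCorners ℝ V₃ H₃)
    {E₁ E₂ B : Type*} (F : Type*)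
    [TopologicalSpace E₁] [ChartedSpace H₁ E₁] [TopologicalSpace E₂] [ChartedSpace H₁' E₂]
    [TopologicalSpace B] [ChartedSpace H₂ B] [TopologicalSpace F] [ChartedSpace H₃ F]
    (π₁ : E₁ → B) (π₂ : E₂ → B) (Φ : E₁ ≃ₘ^∞⟮I₁, I₂⟯ E₂) : Prop where
  bundle₁ : IsSmoothFiberBundle I₁ IB IF F π₁
  bundle₂ : IsSmoothFiberBundle I₂ IB IF F π₂
  proj_comp : ∀ x, π₂ (Φ x) = π₁ x

/-- The Stiefel manifold `St(n,k)`, as a subset of the real `n × k` matrices. -/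
def stiefel (n k : ℕ) : Set (Matrix (Fin n) (Fin k) ℝ) := {Q | Qᵀ * Q = 1}

/-- The vector space `Sym(k)` of real symmetric `k × k` matrices. -/
def symMatrix (k : ℕ) : Submodule ℝ (Matrix (Fin k) (Fin k) ℝ) where
  carrier := {S | Sᵀ = S}
  add_mem' := by
    intro a b ha hb
    simp only [Set.mem_ofPred_eq] at ha hb ⊢
    rw [Matrix.transpose_add, ha, hb]
  zero_mem' := by simp
  smul_mem' := by
    intro c a ha
    simp only [Set.mem_ofPred_eq] at ha ⊢
    rw [Matrix.transpose_smul, ha]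

theorem isOpen_posDef (k : ℕ) :
    IsOpen {S : symMatrix k | (S : Matrix (Fin k) (Fin k) ℝ).PosDef} := by
  have key : {S : symMatrix k | (S : Matrix (Fin k) (Fin k) ℝ).PosDef} =
      {S : symMatrix k | ∀ x ∈ Metric.sphere (0 : Fin k → ℝ) 1,
        0 < x ⬝ᵥ ((S : Matrix (Fin k) (Fin k) ℝ) *ᵥ x)} := by
    ext S
    simp only [Set.mem_ofPred_eq]
    constructor
    · intro h x hx
      have hx0 : x ≠ 0 := by
        rintro rfl
        simp at hx
      simpa using h.dotProduct_mulVec_pos hx0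
    · intro h
      refine Matrix.PosDef.of_dotProduct_mulVec_pos ?_ ?_
      · rw [Matrix.IsHermitian, Matrix.conjTranspose_eq_transpose_of_trivial]
        exact S.2
      · intro x hx
        have hn : 0 < ‖x‖ := norm_pos_iff.mpr hx
        have h1 := h (‖x‖⁻¹ • x) (by simp [norm_smul, hn.ne'])
        rw [Matrix.mulVec_smul, smul_dotProduct, dotProduct_smul, smul_smul, smul_eq_mul] at h1
        have h2 : 0 < ‖x‖⁻¹ * ‖x‖⁻¹ := by positivity
        simpa using (pos_iff_pos_of_mul_pos h1).mp h2
  rw [key, isOpen_iff_eventually]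
  intro S hS
  refine (isCompact_sphere (0 : Fin k → ℝ) 1).eventually_forall_of_forall_eventually ?_
  intro x hx
  have hc : Continuous fun p : symMatrix k × (Fin k → ℝ) =>
      p.2 ⬝ᵥ ((p.1 : Matrix (Fin k) (Fin k) ℝ) *ᵥ p.2) := by
    fun_prop
  exact hc.continuousAt.eventually (lt_mem_nhds (hS x hx))

/-- `Sym⁺(k)`: the manifold of symmetric positive definite `k × k` matrices, an open subset of the
vector space of symmetric matrices. -/
def symPos (k : ℕ) : TopologicalSpace.Opens (symMatrix k) :=
  ⟨{S | (S : Matrix (Fin k) (Fin k) ℝ).PosDef}, isOpen_posDef k⟩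

/-- `Sym(n,k)`: the positive semidefinite `n × n` matrices of rank `k`, as a subset of the real
`n × n` matrices. -/
def symRank (n k : ℕ) : Set (Matrix (Fin n) (Fin n) ℝ) := {A | A.PosSemidef ∧ A.rank = k}

/-- `Gr(k,n)`: the `k`-dimensional linear subspaces of `ℝ^n`. -/
def Gr (k n : ℕ) : Type := {P : Submodule ℝ (Fin n → ℝ) // Module.finrank ℝ P = k}

/-- `π_G : St(n,k) → Gr(k,n)`, which maps `Q` to the span of its columns. -/
def grProj {n k : ℕ} (Q : stiefel n k) : Gr k n :=
  ⟨LinearMap.range (Q : Matrix (Fin n) (Fin k) ℝ).mulVecLin, by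
    have hQ : Q.1ᵀ * Q.1 = 1 := Q.2
    have hinj : Function.Injective (Q : Matrix (Fin n) (Fin k) ℝ).mulVecLin := by
      intro x y hxy
      have := congrArg (fun v => Q.1ᵀ *ᵥ v) hxy
      simpa [Matrix.mulVec_mulVec, hQ] using this
    rw [LinearMap.finrank_range_of_inj hinj, Module.finrank_fin_fun]⟩

/-- The quotient topology on `Gr(k,n)` induced by `π_G`. -/
instance grTopology (k n : ℕ) : TopologicalSpace (Gr k n) :=
  TopologicalSpace.coinduced (grProj (n := n) (k := k)) inferInstance

/-- The orbit equivalence relation of the action of `O(k)` on `St(n,k) × Sym⁺(k)` by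
`(Q, S) ↦ (Q G, Gᵀ S G)`. -/
def assocSetoid (n k : ℕ) : Setoid (stiefel n k × symPos k) where
  r p q := ∃ G ∈ Matrix.orthogonalGroup (Fin k) ℝ,
    q.1.1 = p.1.1 * G ∧ q.2.1.1 = Gᵀ * p.2.1.1 * G
  iseqv :=
    { refl := fun p => ⟨1, one_mem _, by simp, by simp⟩
      symm := by
        rintro p q ⟨G, hG, h1, h2⟩
        have hG1 : G * Gᵀ = 1 := Matrix.mem_orthogonalGroup_iff (Fin k) ℝ |>.mp hG
        have hG2 : Gᵀ * G = 1 := Matrix.mem_orthogonalGroup_iff' (Fin k) ℝ |>.mp hG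
        refine ⟨Gᵀ, (Matrix.mem_orthogonalGroup_iff (Fin k) ℝ).mpr ?_, ?_, ?_⟩
        · simpa [Matrix.star_eq_conjTranspose] using hG2
        · rw [h1, Matrix.mul_assoc, hG1, Matrix.mul_one]
        · rw [h2, Matrix.transpose_transpose]
          simp only [← Matrix.mul_assoc]
          rw [hG1, Matrix.one_mul, Matrix.mul_assoc, hG1, Matrix.mul_one]
      trans := by
        rintro p q r ⟨G, hG, h1, h2⟩ ⟨K, hK, h3, h4⟩
        refine ⟨G * K, mul_mem hG hK, ?_, ?_⟩
        · rw [h3, h1, Matrix.mul_assoc]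
        · rw [h4, h2, Matrix.transpose_mul]
          simp only [Matrix.mul_assoc] }

/-- `M(n,k) = St(n,k) ×_{O(k)} Sym⁺(k) = (St(n,k) × Sym⁺(k)) / O(k)`. -/
def AssocBundle (n k : ℕ) : Type := Quotient (assocSetoid n k)

/-- The quotient topology on `M(n,k)`. -/
instance assocTopology (n k : ℕ) : TopologicalSpace (AssocBundle n k) :=
  inferInstanceAs (TopologicalSpace (Quotient (assocSetoid n k)))

/-- The quotient map `(Q, S) ↦ [Q, S]`. -/
def assocMk {n k : ℕ} (p : stiefel n k × symPos k) : AssocBundle n k :=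
  Quotient.mk (assocSetoid n k) p

/-- `π_M : M(n,k) → Gr(k,n)`, `[Q, S] ↦ π_G(Q)`. -/
def assocProj {n k : ℕ} : AssocBundle n k → Gr k n :=
  Quotient.lift (fun p : stiefel n k × symPos k => grProj p.1) (by
    rintro p q ⟨G, hG, h1, -⟩
    have hG1 : G * Gᵀ = 1 := Matrix.mem_orthogonalGroup_iff (Fin k) ℝ |>.mp hG
    refine Subtype.ext ?_
    change LinearMap.range p.1.1.mulVecLin =
      LinearMap.range q.1.1.mulVecLin
    have h2 : p.1.1 = q.1.1 * Gᵀ := by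
      rw [h1, Matrix.mul_assoc, hG1, Matrix.mul_one]
    apply le_antisymm
    · rw [h2, Matrix.mulVecLin_mul]
      exact LinearMap.range_comp_le_range _ _
    · rw [h1, Matrix.mulVecLin_mul]
      exact LinearMap.range_comp_le_range _ _)

/-- `π_Sym : Sym(n,k) → Gr(k,n)`, which maps a matrix to its image. -/
def symProj {n k : ℕ} (A : symRank n k) : Gr k n :=
  ⟨LinearMap.range (A : Matrix (Fin n) (Fin n) ℝ).mulVecLin, A.2.2⟩

/-- The given atlases are the standard smooth structures: `St(n,k)` and `Sym(n,k)` are embedded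
submanifolds of the spaces of `n × k` and `n × n` matrices, and `Gr(k,n) = St(n,k) / O(k)` and
`M(n,k) = (St(n,k) × Sym⁺(k)) / O(k)` are quotient manifolds, that is, their quotient maps are
submersions. These conditions determine the smooth structures uniquely. -/
structure IsStandard (n k dSt dGr dM dSym : ℕ)
    [ChartedSpace (EuclideanSpace ℝ (Fin dSt)) (stiefel n k)]
    [ChartedSpace (EuclideanSpace ℝ (Fin dGr)) (Gr k n)]
    [ChartedSpace (EuclideanSpace ℝ (Fin dM)) (AssocBundle n k)]
    [ChartedSpace (EuclideanSpace ℝ (Fin dSym)) (symRank n k)] : Prop where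
  stiefel_submanifold :
    IsEmbeddedSubmanifold dSt 𝓘(ℝ, Matrix (Fin n) (Fin k) ℝ) (stiefel n k)
  symRank_submanifold :
    IsEmbeddedSubmanifold dSym 𝓘(ℝ, Matrix (Fin n) (Fin n) ℝ) (symRank n k)
  gr_manifold : IsSmoothManifold dGr (Gr k n)
  gr_submersion : Manifold.IsSubmersion (𝓡 dSt) (𝓡 dGr) ∞ (grProj (n := n) (k := k))
  assoc_manifold : IsSmoothManifold dM (AssocBundle n k)
  assoc_submersion : Manifold.IsSubmersion ((𝓡 dSt).prod 𝓘(ℝ, symMatrix k)) (𝓡 dM) ∞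
    (assocMk (n := n) (k := k))

/-!
The smooth structures in question are known only through universal properties: a map into an
embedded submanifold is smooth as soon as it is smooth into the ambient space
(`Manifold.IsSmoothEmbedding.contMDiffAt_of_comp`), and a map out of the base of a surjective
submersion is smooth as soon as its pullback is (`Manifold.IsSubmersion.contMDiff_of_comp`). Hence
`[Q, S] ↦ Q S Qᵀ` is smooth because `(Q, S) ↦ Q S Qᵀ` is polynomial. It is bijective by linear
algebra: the orthonormal frames `Q` of the image of `A` form one `O(k)`-orbit, and for each of them
`S = Qᵀ A Q` is the only solution of `A = Q S Qᵀ`.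

The inverse is smooth because frames can be chosen smoothly. The inverse function theorem, applied
to squaring of symmetric matrices at `1`, gives a smooth polar retraction `X ↦ X (XᵀX)^{-1/2}` of a
neighbourhood of the Stiefel manifold onto it (`exists_orthonormalization`). Near `Q₀ S₀ Q₀ᵀ`, the
orthonormalization of `A Q₀ S₀⁻¹` is a smooth frame of the image of `A` (`symFrame`), and near the
span of `Q₀` the orthonormalization of the projection of `Q₀` is a smooth frame of the subspace
(`grFrame`). These frames make the inverse and the projection `A ↦ Im A` smooth, and a smooth frame
`s` on an open set of subspaces gives the trivialization `A ↦ (Im A, s(Im A)ᵀ A s(Im A))`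
(`exists_trivialization_symProj`). The bundle `M(n,k)` is then trivialized by transport along the
diffeomorphism. A fiber has a global chart given by any trivialization around its base point
(`IsSmoothFiberBundle.isSubmanifoldDiffeomorphicTo`).

For the existence of the smooth structures, `Gr(k,n)` is identified with the orthogonal projections
of rank `k`, and `M(n,k)` with `Sym(n,k)`, topologically at first; the local sections above show
that these identifications are homeomorphisms. The same sections exhibit each of the spaces as a
local smooth retract of a space of matrices. A local smooth retract of constant rank is an embedded
submanifold (`Topology.IsEmbedding.exists_isSmoothEmbedding`), and the rank is constant because
`O(n)` or `GL(n)` acts linearly and transitively. The sections also show that the quotient maps are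
submersions.
-/

open Set Topology Manifold

/-! ### Local diffeomorphisms and complements -/

section LocalDiffeo

variable {E F : Type*} [NormedAddCommGroup E] [NormedSpace ℝ E] [CompleteSpace E]
  [NormedAddCommGroup F] [NormedSpace ℝ F]

/-- The inverse function theorem with smoothness of the inverse on the whole target: the domain is
shrunk to the open set of points at which the derivative remains invertible. -/
theorem ContDiffOn.exists_openPartialHomeomorph {f : E → F} {U : Set E} (hU : IsOpen U)
    (hf : ContDiffOn ℝ ∞ f U) {x : E} (hx : x ∈ U) {f' : E ≃L[ℝ] F}
    (hf' : HasFDerivAt f (f' : E →L[ℝ] F) x) :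
    ∃ e : OpenPartialHomeomorph E F, x ∈ e.source ∧ e.source ⊆ U ∧ ⇑e = f ∧
      ContDiffOn ℝ ∞ e.symm e.target := by
  have hfx : ContDiffAt ℝ ∞ f x := hf.contDiffAt (hU.mem_nhds hx)
  have hn : (∞ : WithTop ℕ∞) ≠ 0 := by simp
  set e₀ := hfx.toOpenPartialHomeomorph f hf' hn with he₀
  set S : Set E := U ∩ fderiv ℝ f ⁻¹' range ((↑) : (E ≃L[ℝ] F) → (E →L[ℝ] F)) with hS
  have hSo : IsOpen S :=
    (hf.continuousOn_fderiv_of_isOpen hU (by simp)).isOpen_inter_preimage hU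
      ContinuousLinearEquiv.isOpen
  have hxS : x ∈ S := ⟨hx, f', hf'.fderiv.symm⟩
  refine ⟨e₀.restrOpen S hSo, ?_, ?_, rfl, ?_⟩
  · exact ⟨hfx.mem_toOpenPartialHomeomorph_source hf' hn, hxS⟩
  · exact fun y hy => hy.2.1
  · intro y hy
    refine ContDiffAt.contDiffWithinAt ?_
    have hy' := (e₀.restrOpen S hSo).map_target hy
    obtain ⟨L, hL⟩ := hy'.2.2
    have hd : DifferentiableAt ℝ f ((e₀.restrOpen S hSo).symm y) :=
      (hf.contDiffAt (hU.mem_nhds hy'.2.1)).differentiableAt (by simp)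
    refine OpenPartialHomeomorph.contDiffAt_symm (f₀' := L) _ hy ?_ ?_
    · rw [hL]; exact hd.hasFDerivAt
    · exact hf.contDiffAt (hU.mem_nhds hy'.2.1)

end LocalDiffeo

section LinearAlgebra

variable {E F G : Type*} [NormedAddCommGroup E] [NormedSpace ℝ E] [FiniteDimensional ℝ E]
  [NormedAddCommGroup F] [NormedSpace ℝ F] [FiniteDimensional ℝ F]
  [NormedAddCommGroup G] [NormedSpace ℝ G] [FiniteDimensional ℝ G]

/-- An injective linear map is the first inclusion of a product, after a choice of complement of its
range. -/
theorem ContinuousLinearMap.exists_equiv_prod_of_injective (A : E →L[ℝ] G)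
    (hA : Function.Injective A)
    (hd : Module.finrank ℝ E + Module.finrank ℝ F = Module.finrank ℝ G) :
    ∃ L : (E × F) ≃L[ℝ] G, ∀ v, L (v, 0) = A v := by
  obtain ⟨C, hC⟩ := Submodule.exists_isCompl (LinearMap.range (A : E →ₗ[ℝ] G))
  have hr : Module.finrank ℝ (LinearMap.range (A : E →ₗ[ℝ] G)) = Module.finrank ℝ E :=
    LinearMap.finrank_range_of_inj hA
  have hs := Submodule.finrank_add_eq_of_isCompl hC
  have e₂ : F ≃ₗ[ℝ] C := LinearEquiv.ofFinrankEq F C (by omega)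
  let e₁ : E ≃ₗ[ℝ] LinearMap.range (A : E →ₗ[ℝ] G) := LinearEquiv.ofInjective (A : E →ₗ[ℝ] G) hA
  refine ⟨((e₁.prodCongr e₂).trans
    (Submodule.prodEquivOfIsCompl _ _ hC)).toContinuousLinearEquiv, fun v => ?_⟩
  simp [e₁]

/-- A surjective linear map is the first projection of a product, after a choice of complement of
its kernel. -/
theorem ContinuousLinearMap.exists_equiv_prod_of_surjective (A : G →L[ℝ] E)
    (hA : Function.Surjective A)
    (hd : Module.finrank ℝ E + Module.finrank ℝ F = Module.finrank ℝ G) :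
    ∃ L : G ≃L[ℝ] (E × F), ∀ v, (L v).1 = A v := by
  have hk := LinearMap.finrank_range_add_finrank_ker (A : G →ₗ[ℝ] E)
  rw [LinearMap.range_eq_top.2 hA, finrank_top] at hk
  obtain ⟨C, hC⟩ := Submodule.exists_isCompl (LinearMap.ker (A : G →ₗ[ℝ] E))
  have e₂ : LinearMap.ker (A : G →ₗ[ℝ] E) ≃ₗ[ℝ] F := LinearEquiv.ofFinrankEq _ _ (by omega)
  let p : G →ₗ[ℝ] LinearMap.ker (A : G →ₗ[ℝ] E) := Submodule.projectionOnto _ _ hC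
  let l : G →ₗ[ℝ] E × F := (A : G →ₗ[ℝ] E).prod (e₂.toLinearMap ∘ₗ p)
  have hl : Function.Injective l := by
    rw [← LinearMap.ker_eq_bot, LinearMap.ker_eq_bot']
    intro v hv
    have h1 : A v = 0 := congrArg Prod.fst hv
    have h2 : e₂ (p v) = 0 := congrArg Prod.snd hv
    have h3 : p v = 0 := by simpa using h2
    have h4 := Submodule.projectionOnto_apply_left hC ⟨v, h1⟩
    change p v = _ at h4
    rw [h3] at h4
    exact (congrArg Subtype.val h4).symm
  refine ⟨(LinearEquiv.ofInjectiveOfFinrankEq l hl (by simp; omega)).toContinuousLinearEquiv,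
    fun v => rfl⟩

end LinearAlgebra

/-! ### Charts composed with local diffeomorphisms of the model vector space -/

section Charts

variable {E H M : Type*} [NormedAddCommGroup E] [NormedSpace ℝ E] [TopologicalSpace H]
  (I : ModelWithCorners ℝ E H) [I.Boundaryless] [TopologicalSpace M]

/-- A partial homeomorphism of the model vector space, transported to the model space `H` along the
identification `I`, which is a homeomorphism because there is no boundary. -/
noncomputable def OpenPartialHomeomorph.conjModel (e : OpenPartialHomeomorph E E) :
    OpenPartialHomeomorph H H :=
  I.toHomeomorph.toOpenPartialHomeomorph ≫ₕ e ≫ₕ I.toHomeomorph.symm.toOpenPartialHomeomorph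

theorem OpenPartialHomeomorph.extend_trans_conjModel (φ : OpenPartialHomeomorph M H)
    (e : OpenPartialHomeomorph E E) :
    (φ ≫ₕ e.conjModel I).extend I = (φ.extend I).trans e.toPartialEquiv := by
  have hI : ∀ u, I (I.symm u) = u := fun u => I.right_inv (I.range_eq_univ ▸ mem_univ u)
  refine PartialEquiv.ext ?_ ?_ ?_
  · intro x
    simp [conjModel, hI]
  · intro u
    simp [conjModel, hI]
  · ext x
    simp [conjModel]

/-- A chart followed by a diffeomorphism between open subsets of the model vector space is again a
chart. -/
theorem OpenPartialHomeomorph.trans_conjModel_mem_maximalAtlas [ChartedSpace H M] [IsManifold I ∞ M]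
    {φ : OpenPartialHomeomorph M H} (hφ : φ ∈ IsManifold.maximalAtlas I ∞ M)
    (e : OpenPartialHomeomorph E E) (he : ContDiffOn ℝ ∞ e e.source)
    (he' : ContDiffOn ℝ ∞ e.symm e.target) :
    φ ≫ₕ e.conjModel I ∈ IsManifold.maximalAtlas I ∞ M := by
  have hI : ContMDiff 𝓘(ℝ, E) I ∞ I.symm := by
    have := I.contMDiffOn_symm (n := ∞)
    rwa [I.range_eq_univ, contMDiffOn_univ] at this
  have key : ∀ e : OpenPartialHomeomorph E E, ContDiffOn ℝ ∞ e e.source →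
      ContMDiffOn I I ∞ (e.conjModel I) (e.conjModel I).source := by
    intro e he
    exact hI.comp_contMDiffOn (he.contMDiffOn.comp I.contMDiff.contMDiffOn
      (by intro x hx; simpa [conjModel] using hx))
  have h1 := contMDiffOn_of_mem_maximalAtlas hφ
  have h2 := contMDiffOn_symm_of_mem_maximalAtlas hφ
  refine OpenPartialHomeomorph.mem_maximalAtlas_of_contMDiffOn _ ?_ ?_
  · exact (key e he).comp (h1.mono (by intro x hx; exact hx.1)) (by intro x hx; exact hx.2)
  · exact h2.comp ((key e.symm he').mono (by
      intro x hx; simpa [conjModel] using hx.1)) (by intro x hx; exact hx.2)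

end Charts

/-! ### Immersions and submersions from their derivatives -/

section InverseFunction

variable {E H M E' H' N F : Type*}
  [NormedAddCommGroup E] [NormedSpace ℝ E] [TopologicalSpace H]
  [NormedAddCommGroup E'] [NormedSpace ℝ E'] [TopologicalSpace H']
  [NormedAddCommGroup F] [NormedSpace ℝ F]
  {I : ModelWithCorners ℝ E H} [I.Boundaryless] {J : ModelWithCorners ℝ E' H'}
  [TopologicalSpace M] [ChartedSpace H M] [IsManifold I ∞ M]
  [TopologicalSpace N] [ChartedSpace H' N] [IsManifold J ∞ N]

/-- A smooth map read in the preferred charts at `x` and `f x`, on an open domain of smoothness. -/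
theorem ContMDiff.exists_writtenInExtChartAt {f : M → N} (hf : ContMDiff I J ∞ f) (x : M) :
    ∃ U : Set E, IsOpen U ∧ extChartAt I x x ∈ U ∧ U ⊆ (extChartAt I x).target ∧
      (∀ u ∈ U, f ((extChartAt I x).symm u) ∈ (chartAt H' (f x)).source) ∧
      ContDiffOn ℝ ∞ (writtenInExtChartAt I J x f) U ∧
      HasFDerivAt (writtenInExtChartAt I J x f) (mfderiv I J f x : E →L[ℝ] E')
        (extChartAt I x x) := by
  have hcont : ContinuousOn (f ∘ (extChartAt I x).symm) (extChartAt I x).target :=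
    hf.continuous.comp_continuousOn (continuousOn_extChartAt_symm x)
  refine ⟨(extChartAt I x).target ∩ (f ∘ (extChartAt I x).symm) ⁻¹' (chartAt H' (f x)).source,
    hcont.isOpen_inter_preimage (isOpen_extChartAt_target x) (chartAt H' (f x)).open_source,
    ⟨mem_extChartAt_target x, by simp⟩, inter_subset_left, fun u hu => hu.2, ?_, ?_⟩
  · rw [← contMDiffOn_iff_contDiffOn]
    refine (contMDiffOn_extChartAt (I := J) (x := f x)).comp
      (hf.comp_contMDiffOn ((contMDiffOn_extChartAt_symm x).mono inter_subset_left)) ?_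
    exact fun u hu => hu.2
  · have h := (hf.mdifferentiableAt (x := x) (by simp)).hasMFDerivAt.2
    rw [I.range_eq_univ] at h
    exact hasFDerivWithinAt_univ.1 h

variable [FiniteDimensional ℝ E] [FiniteDimensional ℝ E']

/-- The immersion theorem: a smooth map whose derivative at `x` is injective has the local normal
form `u ↦ (u, 0)` around `x`. -/
theorem ContMDiff.isImmersionAtOfComplement [J.Boundaryless] [FiniteDimensional ℝ F] {f : M → N}
    (hf : ContMDiff I J ∞ f) {x : M} (hinj : Function.Injective (mfderiv I J f x))
    (hd : Module.finrank ℝ E + Module.finrank ℝ F = Module.finrank ℝ E') :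
    IsImmersionAtOfComplement F I J ∞ f x := by
  obtain ⟨U, hUo, hxU, hUt, hUs, hUf, hder⟩ := hf.exists_writtenInExtChartAt x
  set g := writtenInExtChartAt I J x f with hg
  set A : E →L[ℝ] E' := mfderiv I J f x with hA
  obtain ⟨L, hL⟩ := A.exists_equiv_prod_of_injective (F := F) hinj hd
  -- `g` is extended to a local diffeomorphism by adding the complementary directions
  set h : E × F → E' := fun p => g p.1 + L (0, p.2) with hh
  have hhs : ContDiffOn ℝ ∞ h (U ×ˢ univ) := by
    refine (hUf.comp contDiff_fst.contDiffOn (fun p hp => hp.1)).add ?_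
    exact (by fun_prop : ContDiff ℝ ∞ fun p : E × F => L (0, p.2)).contDiffOn
  have hhd : HasFDerivAt h (L : (E × F) →L[ℝ] E') (extChartAt I x x, 0) := by
    have h1 : HasFDerivAt (fun p : E × F => g p.1) (A.comp (.fst ℝ E F))
        (extChartAt I x x, 0) :=
      HasFDerivAt.comp (x := ((extChartAt I x x, 0) : E × F)) (f := Prod.fst) hder hasFDerivAt_fst
    have h2 := ((L : (E × F) →L[ℝ] E').comp
      ((ContinuousLinearMap.inr ℝ E F).comp (.snd ℝ E F))).hasFDerivAt (x := (extChartAt I x x, 0))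
    convert! h1.add h2 using 1
    ext p
    · simp [hL]
    · simp
  obtain ⟨e, hxe, heU, hee, hes⟩ :=
    ContDiffOn.exists_openPartialHomeomorph (hUo.prod isOpen_univ) hhs ⟨hxU, mem_univ _⟩ hhd
  -- the codomain chart straightens `h`, the domain chart is restricted accordingly
  set V : Set E := (fun u => ((u, 0) : E × F)) ⁻¹' e.source with hV
  have hVo : IsOpen V := e.open_source.preimage (by fun_prop)
  set φ := chartAt H x ≫ₕ (OpenPartialHomeomorph.ofSet V hVo).conjModel I with hφ
  set ψ := chartAt H' (f x) ≫ₕ (e.symm ≫ₕ L.toHomeomorph.toOpenPartialHomeomorph).conjModel J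
    with hψ
  have hφe : φ.extend I =
      (extChartAt I x).trans (OpenPartialHomeomorph.ofSet V hVo).toPartialEquiv :=
    OpenPartialHomeomorph.extend_trans_conjModel I _ _
  have hψe : ψ.extend J = (extChartAt J (f x)).trans
      (e.symm ≫ₕ L.toHomeomorph.toOpenPartialHomeomorph).toPartialEquiv :=
    OpenPartialHomeomorph.extend_trans_conjModel J _ _
  have hφs : ∀ y, y ∈ φ.source ↔ y ∈ (extChartAt I x).source ∧ extChartAt I x y ∈ V := by
    intro y
    rw [← φ.extend_source (I := I), hφe]
    simp
  have hψs : ∀ y, y ∈ ψ.source ↔ y ∈ (extChartAt J (f x)).source ∧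
      extChartAt J (f x) y ∈ e.target := by
    intro y
    rw [← ψ.extend_source (I := J), hψe]
    simp
  have hval : ∀ u, h (u, 0) = g u := fun u => by simp [hh]
  have hmem : ∀ u ∈ V, f ((extChartAt I x).symm u) ∈ ψ.source := by
    intro u hu
    have h1 : (u, (0 : F)) ∈ e.source := hu
    have h2 := e.map_source h1
    rw [hee, hval u] at h2
    exact (hψs _).2 ⟨by simpa using hUs u (heU h1).1, h2⟩
  have hxV : extChartAt I x x ∈ V := hxe
  refine IsImmersionAtOfComplement.mk_of_charts L φ ψ ?_ ?_ ?_ ?_ ?_ ?_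
  · exact (hφs x).2 ⟨mem_extChartAt_source x, hxV⟩
  · simpa using hmem _ hxV
  · exact OpenPartialHomeomorph.trans_conjModel_mem_maximalAtlas I
      (IsManifold.chart_mem_maximalAtlas x) _ contDiffOn_id contDiffOn_id
  · refine OpenPartialHomeomorph.trans_conjModel_mem_maximalAtlas J
      (IsManifold.chart_mem_maximalAtlas (f x)) _ ?_ ?_
    · exact L.contDiff.comp_contDiffOn (hes.mono (by intro y hy; simpa using hy))
    · have : ContDiffOn ℝ ∞ (e ∘ L.symm) (L.symm ⁻¹' e.source) :=
        (hee ▸ hhs.mono heU).comp L.symm.contDiff.contDiffOn (fun _ h => h)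
      exact this.mono (by intro y hy; simpa using hy)
  · intro y hy
    obtain ⟨h1, h2⟩ := (hφs y).1 hy
    have := hmem _ h2
    rwa [(extChartAt I x).left_inv h1] at this
  · intro u hu
    rw [hφe] at hu
    have h1 : u ∈ V := hu.1
    rw [hφe, hψe]
    change L (e.symm (g u)) = L (u, 0)
    rw [← hval u, ← hee, e.left_inv h1]

/-- The submersion theorem: a smooth map whose derivative at `x` is surjective has the local normal
form `(u, v) ↦ u` around `x`. -/
theorem ContMDiff.isSubmersionAtOfComplement [FiniteDimensional ℝ F] {f : M → N}
    (hf : ContMDiff I J ∞ f) {x : M} (hsurj : Function.Surjective (mfderiv I J f x))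
    (hd : Module.finrank ℝ E' + Module.finrank ℝ F = Module.finrank ℝ E) :
    IsSubmersionAtOfComplement F I J ∞ f x := by
  obtain ⟨U, hUo, hxU, hUt, hUs, hUf, hder⟩ := hf.exists_writtenInExtChartAt x
  set g := writtenInExtChartAt I J x f with hg
  set A : E →L[ℝ] E' := mfderiv I J f x with hA
  obtain ⟨L, hL⟩ := A.exists_equiv_prod_of_surjective (F := F) hsurj hd
  -- the components of `L` along the complement turn `g` into a local diffeomorphism
  set h : E → E' × F := fun u => (g u, (L u).2) with hh
  have hhs : ContDiffOn ℝ ∞ h U :=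
    hUf.prodMk (by fun_prop : ContDiff ℝ ∞ fun u => (L u).2).contDiffOn
  have hhd : HasFDerivAt h (L : E →L[ℝ] E' × F) (extChartAt I x x) := by
    have h2 := ((ContinuousLinearMap.snd ℝ E' F).comp (L : E →L[ℝ] E' × F)).hasFDerivAt
      (x := extChartAt I x x)
    convert! hder.prodMk h2 using 1
    ext p
    · simp [hL]
    · simp
  obtain ⟨e, hxe, heU, hee, hes⟩ := ContDiffOn.exists_openPartialHomeomorph hUo hhs hxU hhd
  set φ := chartAt H x ≫ₕ (e ≫ₕ L.symm.toHomeomorph.toOpenPartialHomeomorph).conjModel I with hφ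
  have hφe : φ.extend I = (extChartAt I x).trans
      (e ≫ₕ L.symm.toHomeomorph.toOpenPartialHomeomorph).toPartialEquiv :=
    OpenPartialHomeomorph.extend_trans_conjModel I _ _
  have hφs : ∀ y, y ∈ φ.source ↔ y ∈ (extChartAt I x).source ∧ extChartAt I x y ∈ e.source := by
    intro y
    rw [← φ.extend_source (I := I), hφe]
    simp
  refine IsSubmersionAtOfComplement.mk_of_charts L φ (chartAt H' (f x)) ?_ ?_ ?_ ?_ ?_ ?_
  · exact (hφs x).2 ⟨mem_extChartAt_source x, hxe⟩
  · simp
  · refine OpenPartialHomeomorph.trans_conjModel_mem_maximalAtlas I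
      (IsManifold.chart_mem_maximalAtlas x) _ ?_ ?_
    · exact L.symm.contDiff.comp_contDiffOn
        ((hee ▸ hhs.mono heU : ContDiffOn ℝ ∞ e e.source).mono (by intro y hy; simpa using hy))
    · have : ContDiffOn ℝ ∞ (e.symm ∘ L) (L ⁻¹' e.target) :=
        hes.comp L.contDiff.contDiffOn (fun _ h => h)
      exact this.mono (by intro y hy; simpa using hy)
  · exact IsManifold.chart_mem_maximalAtlas (f x)
  · intro y hy
    obtain ⟨h1, h2⟩ := (hφs y).1 hy
    have := hUs _ (heU h2)
    rwa [(extChartAt I x).left_inv h1] at this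
  · intro u hu
    rw [hφe] at hu ⊢
    have h1 : L u ∈ e.target := by simpa using hu.1
    change g (e.symm (L u)) = (L u).1
    have h2 : h (e.symm (L u)) = L u := by rw [← hee, e.right_inv h1]
    exact congrArg Prod.fst h2

/-- A smooth map with differentiable local left inverses is an immersion, since its derivative then
has a left inverse. -/
theorem ContMDiff.isImmersion_of_leftInverse [J.Boundaryless] {f : M → N} (hf : ContMDiff I J ∞ f)
    (h : ∀ x, ∃ g : N → M, MDifferentiableAt J I g (f x) ∧ g ∘ f =ᶠ[𝓝 x] id) :
    IsImmersion I J ∞ f := by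
  have hinj : ∀ x, Function.Injective (mfderiv I J f x) := by
    intro x
    obtain ⟨g, hg, hgf⟩ := h x
    have h1 := mfderiv_comp x hg (hf.mdifferentiableAt (by simp))
    rw [hgf.mfderiv_eq, mfderiv_id] at h1
    intro v w hvw
    have hv := congrArg (fun T => T v) h1
    have hw := congrArg (fun T => T w) h1
    have : v = w := hv.trans ((congrArg (mfderiv J I g (f x)) hvw).trans hw.symm)
    exact this
  let F := EuclideanSpace ℝ (Fin (Module.finrank ℝ E' - Module.finrank ℝ E))
  refine IsImmersionOfComplement.isImmersion (F := F) fun x => ?_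
  refine hf.isImmersionAtOfComplement (hinj x) ?_
  let A : E →L[ℝ] E' := mfderiv I J f x
  have : Module.finrank ℝ E ≤ Module.finrank ℝ E' :=
    LinearMap.finrank_le_finrank_of_injective
      (f := (A : E →ₗ[ℝ] E')) (hinj x)
  simp [F]; omega

/-- A smooth map with a differentiable local section through every point of its domain is a
submersion, since its derivative then has a right inverse. -/
theorem ContMDiff.isSubmersion_of_rightInverse {f : M → N} (hf : ContMDiff I J ∞ f)
    (h : ∀ x, ∃ g : N → M, MDifferentiableAt J I g (f x) ∧ g (f x) = x ∧ f ∘ g =ᶠ[𝓝 (f x)] id) :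
    IsSubmersion I J ∞ f := by
  have hsurj : ∀ x, Function.Surjective (mfderiv I J f x) := by
    intro x
    obtain ⟨g, hg, hgx, hgf⟩ := h x
    have h1 := mfderiv_comp (f x) (by rw [hgx]; exact hf.mdifferentiableAt (by simp)) hg
    rw [hgf.mfderiv_eq, mfderiv_id] at h1
    rw [hgx] at h1
    intro v
    exact ⟨mfderiv J I g (f x) v, (congrArg (fun T => T v) h1).symm⟩
  let F := EuclideanSpace ℝ (Fin (Module.finrank ℝ E - Module.finrank ℝ E'))
  refine IsSubmersionOfComplement.isSubmersion (F := F) fun x => ?_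
  refine hf.isSubmersionAtOfComplement (hsurj x) ?_
  let A : E →L[ℝ] E' := mfderiv I J f x
  have : Module.finrank ℝ E' ≤ Module.finrank ℝ E :=
    LinearMap.finrank_le_finrank_of_surjective
      (f := (A : E →ₗ[ℝ] E')) (hsurj x)
  simp [F]; omega

end InverseFunction

/-! ### Universal properties of embeddings and submersions -/

section UniversalProperties

variable {E H M E' H' N E'' H'' Z : Type*}
  [NormedAddCommGroup E] [NormedSpace ℝ E] [TopologicalSpace H]
  [NormedAddCommGroup E'] [NormedSpace ℝ E'] [TopologicalSpace H']
  [NormedAddCommGroup E''] [NormedSpace ℝ E''] [TopologicalSpace H'']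
  {I : ModelWithCorners ℝ E H} {J : ModelWithCorners ℝ E' H'} {K : ModelWithCorners ℝ E'' H''}
  [TopologicalSpace M] [ChartedSpace H M]
  [TopologicalSpace N] [ChartedSpace H' N]
  [TopologicalSpace Z] [ChartedSpace H'' Z]

/-- A map into an embedded manifold is smooth as soon as it is smooth as a map into the ambient
manifold. -/
theorem Manifold.IsSmoothEmbedding.contMDiffAt_of_comp {ι : M → N}
    (hι : IsSmoothEmbedding I J ∞ ι) {f : Z → M} {z : Z} (h : ContMDiffAt K J ∞ (ι ∘ f) z) :
    ContMDiffAt K I ∞ f z := by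
  rw [ContMDiffAt.iff_comp_isImmersionAt (hι.isImmersion.isImmersionAt (f z))]
  exact ⟨hι.isEmbedding.isInducing.continuousAt_iff.2 h.continuousAt, h⟩

/-- A submersion has a smooth local section through any point: in the charts of the normal form, the
coordinate along the fiber is kept constant. -/
theorem Manifold.IsSubmersionAt.exists_section [I.Boundaryless] {q : M → N} {x : M}
    (hq : IsSubmersionAt I J ∞ q x) :
    ∃ s : N → M, ContMDiffAt J I ∞ s (q x) ∧ s (q x) = x ∧ q ∘ s =ᶠ[𝓝 (q x)] id := by
  set φ := hq.domChart
  set ψ := hq.codChart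
  set L := hq.equiv
  have hx : x ∈ (φ.extend I).source := by simpa using hq.mem_domChart_source
  have hψ : q x ∈ (ψ.extend J).source := by simpa using hq.mem_codChart_source
  set t : N → E := fun y => L.symm (ψ.extend J y, (L (φ.extend I x)).2) with ht
  have hw : ∀ u ∈ (φ.extend I).target, ψ.extend J (q ((φ.extend I).symm u)) = (L u).1 :=
    hq.writtenInCharts
  have htx : t (q x) = φ.extend I x := by
    have := hw _ ((φ.extend I).map_source hx)
    rw [(φ.extend I).left_inv hx] at this
    rw [ht]
    simp only [this, Prod.mk.eta, L.symm_apply_apply]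
  have hts : ContMDiffAt J 𝓘(ℝ, E) ∞ t (q x) := by
    have h1 : ContMDiffAt J 𝓘(ℝ, E') ∞ (ψ.extend J) (q x) :=
      ψ.contMDiffAt_extend hq.codChart_mem_maximalAtlas hq.mem_codChart_source
    have h2 : ContDiff ℝ ∞ fun w : E' => L.symm (w, (L (φ.extend I x)).2) := by fun_prop
    exact h2.contMDiff.contMDiffAt.comp (q x) h1
  have hto : IsOpen (φ.extend I).target := φ.isOpen_extend_target
  have htm : ∀ᶠ y in 𝓝 (q x), t y ∈ (φ.extend I).target :=
    hts.continuousAt.eventually (hto.mem_nhds (htx ▸ (φ.extend I).map_source hx))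
  refine ⟨(φ.extend I).symm ∘ t, ?_, ?_, ?_⟩
  · refine ContMDiffAt.comp (q x) ?_ hts
    have h3 := contMDiffOn_extend_symm (n := ∞) hq.domChart_mem_maximalAtlas
    rw [I.image_eq, ← φ.extend_target] at h3
    exact h3.contMDiffAt (hto.mem_nhds (htx ▸ (φ.extend I).map_source hx))
  · rw [Function.comp_apply, htx, (φ.extend I).left_inv hx]
  · have hψn : (ψ.extend J).source ∈ 𝓝 (q x) := ψ.extend_source_mem_nhds hq.mem_codChart_source
    filter_upwards [htm, hψn] with y hy hy'
    have h1 := hw _ hy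
    have h2 : q ((φ.extend I).symm (t y)) ∈ (ψ.extend J).source := by
      have := hq.source_subset_preimage_source
        (show (φ.extend I).symm (t y) ∈ φ.source by
          have := (φ.extend I).map_target hy
          rwa [φ.extend_source] at this)
      rw [ψ.extend_source]; exact this
    refine (ψ.extend J).injOn h2 hy' ?_
    rw [h1]
    simp [ht]

/-- A map out of the base of a surjective submersion is smooth as soon as its pullback is. -/
theorem Manifold.IsSubmersion.contMDiff_of_comp [I.Boundaryless] {q : M → N}
    (hq : IsSubmersion I J ∞ q) (hs : Function.Surjective q) {f : N → Z}
    (h : ContMDiff I K ∞ (f ∘ q)) : ContMDiff J K ∞ f := by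
  intro y
  obtain ⟨x, rfl⟩ := hs y
  obtain ⟨s, hs, -, hqs⟩ := (hq.isSubmersionAt x).exists_section
  refine ((h.contMDiffAt.comp (q x) hs).congr_of_eventuallyEq ?_)
  filter_upwards [hqs] with y hy
  exact congrArg f hy.symm

end UniversalProperties

/-! ### Smooth structures on local retracts -/

section Retraction

variable {X V : Type*} [TopologicalSpace X] [NormedAddCommGroup V] [NormedSpace ℝ V]

/-- `IsSmoothRetractionOn ρ W S`: on the open set `W`, the smooth map `ρ` takes values in `S`, and
it fixes the points of `S ∩ W`. -/
structure IsSmoothRetractionOn (ρ : V → V) (W S : Set V) : Prop where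
  isOpen : IsOpen W
  contDiffOn : ContDiffOn ℝ ∞ ρ W
  mapsTo : MapsTo ρ W S
  eq_self : ∀ y ∈ S ∩ W, ρ y = y

/-- The derivative of a retraction at a fixed point is a projection, by the chain rule for
`ρ ∘ ρ = ρ`. -/
theorem IsSmoothRetractionOn.isIdempotentElem_fderiv {ρ : V → V} {W S : Set V}
    (h : IsSmoothRetractionOn ρ W S) {y : V} (hy : y ∈ S ∩ W) :
    (fderiv ℝ ρ y).comp (fderiv ℝ ρ y) = fderiv ℝ ρ y := by
  have hd : DifferentiableAt ℝ ρ y :=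
    (h.contDiffOn.contDiffAt (h.isOpen.mem_nhds hy.2)).differentiableAt (by simp)
  have h1 : ρ ∘ ρ =ᶠ[𝓝 y] ρ := by
    have h2 : ∀ᶠ z in 𝓝 y, ρ z ∈ W :=
      hd.continuousAt.eventually (by rw [h.eq_self y hy]; exact h.isOpen.mem_nhds hy.2)
    filter_upwards [h2, h.isOpen.mem_nhds hy.2] with z hz hzW
    exact h.eq_self _ ⟨h.mapsTo hzW, hz⟩
  have h2 := fderiv_comp y (g := ρ) (by rw [h.eq_self y hy]; exact hd) hd
  rw [h1.fderiv_eq, h.eq_self y hy] at h2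
  exact h2.symm

variable [FiniteDimensional ℝ V]

/-- The chart of a smooth retract around one of its points: the linear projection to the tangent
space, which is the range of the derivative of the retraction. It is the restriction of a smooth
map of the ambient space, and its inverse is smooth as a map into the ambient space by the inverse
function theorem. -/
theorem IsSmoothRetractionOn.exists_chart {ι : X → V} (hι : IsEmbedding ι) {ρ : V → V} {W : Set V}
    (h : IsSmoothRetractionOn ρ W (range ι)) {x₀ : X} (hx₀ : ι x₀ ∈ W) {d : ℕ}
    (hd : Module.finrank ℝ (LinearMap.range (fderiv ℝ ρ (ι x₀) : V →ₗ[ℝ] V)) = d) :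
    ∃ (c : OpenPartialHomeomorph X (EuclideanSpace ℝ (Fin d)))
      (α : V → EuclideanSpace ℝ (Fin d)), x₀ ∈ c.source ∧ ContDiff ℝ ∞ α ∧ ⇑c = α ∘ ι ∧
        ContDiffOn ℝ ∞ (ι ∘ c.symm) c.target := by
  set p : V →L[ℝ] V := fderiv ℝ ρ (ι x₀) with hp
  have hpp : ∀ v, p (p v) = p v := fun v =>
    congrArg (fun T => T v) (h.isIdempotentElem_fderiv ⟨mem_range_self x₀, hx₀⟩)
  let T := LinearMap.range (p : V →ₗ[ℝ] V)
  let θ : T ≃L[ℝ] EuclideanSpace ℝ (Fin d) :=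
    ContinuousLinearEquiv.ofFinrankEq (by rw [hd]; simp)
  -- `p = b ∘ a` factors through the coordinates of its range, with `a ∘ b = 1`
  let a : V →L[ℝ] EuclideanSpace ℝ (Fin d) :=
    (θ : T →L[ℝ] _).comp (p.codRestrict T fun v => ⟨v, rfl⟩)
  let b : EuclideanSpace ℝ (Fin d) →L[ℝ] V := T.subtypeL.comp (θ.symm : _ →L[ℝ] T)
  have hba : ∀ v, b (a v) = p v := by
    intro v
    simp [a, b]
    rfl
  have hab : ∀ t, a (b t) = t := by
    intro t
    obtain ⟨v, hv⟩ := (θ.symm t).2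
    have h1 : p (b t) = b t := by
      change p (θ.symm t : V) = (θ.symm t : V)
      rw [← hv]
      exact hpp v
    have h2 : (p.codRestrict T fun v => ⟨v, rfl⟩) (b t) = θ.symm t := Subtype.ext h1
    change θ ((p.codRestrict T fun v => ⟨v, rfl⟩) (b t)) = t
    rw [h2, θ.apply_symm_apply]
  have hρ₀ : ρ (ι x₀) = ι x₀ := h.eq_self _ ⟨mem_range_self x₀, hx₀⟩
  have hρd : HasFDerivAt ρ p (ι x₀) :=
    ((h.contDiffOn.contDiffAt (h.isOpen.mem_nhds hx₀)).differentiableAt (by simp)).hasFDerivAt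
  -- a diffeomorphism near `ι x₀` that maps the retract into the range of `p`
  set Ψ : V → V := fun y => p (ρ y - ι x₀) + ((y - ρ y) - p (y - ρ y)) with hΨ
  have hΨs : ContDiffOn ℝ ∞ Ψ W := by
    have := h.contDiffOn
    fun_prop
  have hΨd : HasFDerivAt Ψ ((ContinuousLinearEquiv.refl ℝ V : V ≃L[ℝ] V) : V →L[ℝ] V)
      (ι x₀) := by
    have h1 := p.hasFDerivAt.comp (ι x₀) (hρd.sub_const (ι x₀))
    have h2 := (hasFDerivAt_id (𝕜 := ℝ) (ι x₀)).sub hρd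
    have h3 := p.hasFDerivAt.comp (ι x₀) h2
    convert! h1.add (h2.sub h3) using 1
    ext v
    simp [hpp]
  obtain ⟨e, hxe, heW, hee, hes⟩ := hΨs.exists_openPartialHomeomorph h.isOpen hx₀ hΨd
  have hΨι : ∀ x, ι x ∈ W → Ψ (ι x) = p (ι x - ι x₀) := by
    intro x hx
    simp [hΨ, h.eq_self _ ⟨mem_range_self x, hx⟩]
  have haΨ : ∀ y, a (Ψ y) = a (ρ y - ι x₀) := by
    intro y
    simp only [hΨ, map_add, map_sub, ← hba, hab]
    abel
  let α : V → EuclideanSpace ℝ (Fin d) := fun y => a (y - ι x₀)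
  have hαs : ContDiff ℝ ∞ α := by fun_prop
  let B : Set (EuclideanSpace ℝ (Fin d)) := b ⁻¹' e.target
  have hBo : IsOpen B := e.open_target.preimage b.continuous
  have hβ : ContDiffOn ℝ ∞ (fun t => ρ (e.symm (b t))) B :=
    h.contDiffOn.comp (hes.comp b.contDiff.contDiffOn fun t ht => ht)
      fun t ht => heW (e.map_target ht)
  have : Nonempty X := ⟨x₀⟩
  let τ : EuclideanSpace ℝ (Fin d) → X := fun t => Function.invFun ι (ρ (e.symm (b t)))
  have hτ : ∀ t ∈ B, ι (τ t) = ρ (e.symm (b t)) := fun t ht =>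
    Function.invFun_eq (h.mapsTo (heW (e.map_target ht)))
  have hbα : ∀ x, ι x ∈ e.source → b (α (ι x)) = e (ι x) := by
    intro x hx
    rw [hee, hΨι x (heW hx), ← hba]
  let c : OpenPartialHomeomorph X (EuclideanSpace ℝ (Fin d)) :=
    { toFun := α ∘ ι
      invFun := τ
      source := ι ⁻¹' e.source
      target := B ∩ (fun t => ρ (e.symm (b t))) ⁻¹' e.source
      map_source' := by
        intro x hx
        have h1 := hbα x hx
        refine ⟨?_, ?_⟩
        · change b (α (ι x)) ∈ e.target
          rw [h1]; exact e.map_source hx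
        · change ρ (e.symm (b (α (ι x)))) ∈ e.source
          rw [h1, e.left_inv hx, h.eq_self _ ⟨mem_range_self x, heW hx⟩]
          exact hx
      map_target' := by
        rintro t ⟨ht, ht'⟩
        change ι (τ t) ∈ e.source
        rw [hτ t ht]; exact ht'
      left_inv' := by
        intro x hx
        change Function.invFun ι (ρ (e.symm (b (α (ι x))))) = x
        rw [hbα x hx, e.left_inv hx, h.eq_self _ ⟨mem_range_self x, heW hx⟩]
        exact Function.leftInverse_invFun hι.injective x
      right_inv' := by
        rintro t ⟨ht, -⟩
        change a (ι (τ t) - ι x₀) = t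
        rw [hτ t ht, ← haΨ, ← hee, e.right_inv ht, hab]
      open_source := e.open_source.preimage hι.continuous
      open_target := hβ.continuousOn.isOpen_inter_preimage hBo e.open_source
      continuousOn_toFun := (hαs.continuous.comp hι.continuous).continuousOn
      continuousOn_invFun := by
        rw [hι.isInducing.continuousOn_iff]
        exact (hβ.continuousOn.mono inter_subset_left).congr fun t ht => hτ t ht.1 }
  refine ⟨c, α, hxe, hαs, rfl, ?_⟩
  exact (hβ.mono inter_subset_left).congr fun t ht => hτ t ht.1

/-- A subspace that is locally a smooth retract of constant rank is an embedded submanifold. -/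
theorem Topology.IsEmbedding.exists_isSmoothEmbedding {ι : X → V} (hι : IsEmbedding ι) {d : ℕ}
    (h : ∀ x, ∃ (ρ : V → V) (W : Set V), IsSmoothRetractionOn ρ W (range ι) ∧ ι x ∈ W ∧
      Module.finrank ℝ (LinearMap.range (fderiv ℝ ρ (ι x) : V →ₗ[ℝ] V)) = d) :
    ∃ _ : ChartedSpace (EuclideanSpace ℝ (Fin d)) X,
      IsSmoothManifold d X ∧ IsSmoothEmbedding (𝓡 d) 𝓘(ℝ, V) ∞ ι := by
  have hc : ∀ x₀, ∃ (c : OpenPartialHomeomorph X (EuclideanSpace ℝ (Fin d)))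
      (α : V → EuclideanSpace ℝ (Fin d)), x₀ ∈ c.source ∧ ContDiff ℝ ∞ α ∧ ⇑c = α ∘ ι ∧
        ContDiffOn ℝ ∞ (ι ∘ c.symm) c.target := by
    intro x₀
    obtain ⟨ρ, W, hρ, hx, hr⟩ := h x₀
    exact hρ.exists_chart hι hx hr
  choose c α hcs hαs hcα hcι using hc
  let cs : ChartedSpace (EuclideanSpace ℝ (Fin d)) X :=
    { atlas := range c
      chartAt := c
      mem_chart_source := hcs
      chart_mem_atlas := mem_range_self }
  have hM : IsManifold (𝓡 d) ∞ X := by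
    refine isManifold_of_contDiffOn _ _ _ ?_
    rintro _ _ ⟨x, rfl⟩ ⟨y, rfl⟩
    have : ContDiffOn ℝ ∞ (α y ∘ (ι ∘ (c x).symm)) (c x).target :=
      (hαs y).comp_contDiffOn (hcι x)
    refine (this.mono ?_).congr ?_
    · intro t ht
      exact ht.1.1
    · intro t ht
      change c y ((c x).symm t) = _
      rw [hcα y]; rfl
  have hch : ∀ x, c x ∈ IsManifold.maximalAtlas (𝓡 d) ∞ X :=
    fun x => IsManifold.subset_maximalAtlas (mem_range_self x)
  have hιs : ContMDiff (𝓡 d) 𝓘(ℝ, V) ∞ ι := by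
    intro x
    have h1 : ContMDiffAt (𝓡 d) (𝓡 d) ∞ (c x) x :=
      contMDiffAt_of_mem_maximalAtlas (hch x) (hcs x)
    have h2 : ContMDiffAt (𝓡 d) 𝓘(ℝ, V) ∞ (ι ∘ (c x).symm) (c x x) :=
      ((hcι x).contDiffAt ((c x).open_target.mem_nhds ((c x).map_source (hcs x)))).contMDiffAt
    refine (h2.comp x h1).congr_of_eventuallyEq ?_
    filter_upwards [(c x).open_source.mem_nhds (hcs x)] with y hy
    simp [(c x).left_inv hy]
  have : T2Space X := hι.t2Space
  have : SecondCountableTopology X := hι.secondCountableTopology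
  refine ⟨cs, ⟨inferInstance, inferInstance, hM⟩, ?_, hι⟩
  refine hιs.isImmersion_of_leftInverse fun x => ⟨(c x).symm ∘ α x, ?_, ?_⟩
  · have h1 : ContMDiffAt (𝓡 d) (𝓡 d) ∞ (c x).symm (α x (ι x)) := by
      have : α x (ι x) = c x x := by rw [hcα]; rfl
      rw [this]
      exact contMDiffAt_symm_of_mem_maximalAtlas (hch x) ((c x).map_source (hcs x))
    exact (h1.comp (ι x) (hαs x).contMDiff.contMDiffAt).mdifferentiableAt (by simp)
  · filter_upwards [(c x).open_source.mem_nhds (hcs x)] with y hy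
    have : α x (ι y) = c x y := by rw [hcα]; rfl
    simp [this, (c x).left_inv hy]

/-- If the linear automorphisms preserving the image act transitively on it, then a local retraction
at one point suffices: conjugation moves it to any other point without changing its rank. -/
theorem Topology.IsEmbedding.exists_isSmoothEmbedding_of_homogeneous {ι : X → V}
    (hι : IsEmbedding ι) (x₀ : X) {ρ : V → V} {W : Set V}
    (hρ : IsSmoothRetractionOn ρ W (range ι)) (hx₀ : ι x₀ ∈ W)
    (htrans : ∀ x, ∃ L : V ≃L[ℝ] V, L '' range ι = range ι ∧ L (ι x₀) = ι x) :
    ∃ (d : ℕ) (_ : ChartedSpace (EuclideanSpace ℝ (Fin d)) X),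
      IsSmoothManifold d X ∧ IsSmoothEmbedding (𝓡 d) 𝓘(ℝ, V) ∞ ι := by
  refine ⟨Module.finrank ℝ (LinearMap.range (fderiv ℝ ρ (ι x₀) : V →ₗ[ℝ] V)),
    hι.exists_isSmoothEmbedding fun x => ?_⟩
  obtain ⟨L, hL, hLx⟩ := htrans x
  have hLsymm : L.symm (ι x) = ι x₀ := by rw [← hLx, L.symm_apply_apply]
  refine ⟨fun y => L (ρ (L.symm y)), L.symm ⁻¹' W, ⟨?_, ?_, ?_, ?_⟩, ?_, ?_⟩
  · exact hρ.isOpen.preimage L.symm.continuous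
  · exact L.contDiff.comp_contDiffOn
      (hρ.contDiffOn.comp L.symm.contDiff.contDiffOn fun y hy => hy)
  · intro y hy
    rw [← hL]
    exact mem_image_of_mem L (hρ.mapsTo hy)
  · rintro y ⟨hy, hyW⟩
    rw [← hL] at hy
    obtain ⟨z, hz, rfl⟩ := hy
    have hzW : z ∈ W := by simpa using hyW
    simp [hρ.eq_self z ⟨hz, hzW⟩]
  · simpa [hLsymm] using hx₀
  -- the derivative of the transported retraction is conjugate to the original one
  · have h1 : HasFDerivAt ρ (fderiv ℝ ρ (ι x₀)) (L.symm (ι x)) := by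
      rw [hLsymm]
      exact ((hρ.contDiffOn.contDiffAt (hρ.isOpen.mem_nhds hx₀)).differentiableAt
        (by simp)).hasFDerivAt
    have h2 : HasFDerivAt (fun y => L (ρ (L.symm y)))
        ((L : V →L[ℝ] V).comp ((fderiv ℝ ρ (ι x₀)).comp (L.symm : V →L[ℝ] V))) (ι x) :=
      (L : V →L[ℝ] V).hasFDerivAt.comp (ι x) (h1.comp (ι x) (L.symm : V →L[ℝ] V).hasFDerivAt)
    rw [h2.fderiv]
    have h3 : LinearMap.range (((L : V →L[ℝ] V).comp
        ((fderiv ℝ ρ (ι x₀)).comp (L.symm : V →L[ℝ] V)) : V →L[ℝ] V) : V →ₗ[ℝ] V) =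
        (LinearMap.range (fderiv ℝ ρ (ι x₀) : V →ₗ[ℝ] V)).map
          (L.toLinearEquiv : V →ₗ[ℝ] V) := by
      ext v
      simp only [LinearMap.mem_range, Submodule.mem_map]
      constructor
      · rintro ⟨w, rfl⟩
        exact ⟨_, ⟨L.symm w, rfl⟩, rfl⟩
      · rintro ⟨_, ⟨w, rfl⟩, rfl⟩
        exact ⟨L w, by simp⟩
    rw [h3]
    exact LinearEquiv.finrank_map_eq L.toLinearEquiv _

end Retraction

/-! ### Matrix calculus and smooth orthonormalization -/

section MatrixCalculus

variable {l m n k : ℕ} {E : Type*} [NormedAddCommGroup E] [NormedSpace ℝ E]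

/-- Matrix multiplication as a continuous bilinear map. -/
noncomputable def matrixMulCLM (l m n : ℕ) : Matrix (Fin l) (Fin m) ℝ →L[ℝ]
    Matrix (Fin m) (Fin n) ℝ →L[ℝ] Matrix (Fin l) (Fin n) ℝ :=
  LinearMap.toContinuousLinearMap
    (LinearMap.toContinuousLinearMap.toLinearMap ∘ₗ
      LinearMap.mk₂ ℝ (fun (A : Matrix (Fin l) (Fin m) ℝ) (B : Matrix (Fin m) (Fin n) ℝ) => A * B)
        Matrix.add_mul Matrix.smul_mul Matrix.mul_add (fun c A B => Matrix.mul_smul A c B))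

theorem matrixMulCLM_apply (A : Matrix (Fin l) (Fin m) ℝ) (B : Matrix (Fin m) (Fin n) ℝ) :
    matrixMulCLM l m n A B = A * B := rfl

/-- Transposition as a continuous linear map. -/
noncomputable def matrixTransposeCLM (m n : ℕ) :
    Matrix (Fin m) (Fin n) ℝ →L[ℝ] Matrix (Fin n) (Fin m) ℝ :=
  LinearMap.toContinuousLinearMap (Matrix.transposeLinearEquiv (Fin m) (Fin n) ℝ ℝ).toLinearMap

theorem contDiff_matrix_mul : ContDiff ℝ ∞
    fun p : Matrix (Fin l) (Fin m) ℝ × Matrix (Fin m) (Fin n) ℝ => p.1 * p.2 := by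
  have : ContDiff ℝ ∞ fun p : Matrix (Fin l) (Fin m) ℝ × Matrix (Fin m) (Fin n) ℝ =>
    matrixMulCLM l m n p.1 p.2 := by fun_prop
  exact this

theorem contDiff_matrix_transpose :
    ContDiff ℝ ∞ fun A : Matrix (Fin m) (Fin n) ℝ => Aᵀ :=
  (matrixTransposeCLM m n).contDiff

theorem ContDiffOn.matrix_mul {f : E → Matrix (Fin l) (Fin m) ℝ} {g : E → Matrix (Fin m) (Fin n) ℝ}
    {s : Set E} (hf : ContDiffOn ℝ ∞ f s) (hg : ContDiffOn ℝ ∞ g s) :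
    ContDiffOn ℝ ∞ (fun x => f x * g x) s :=
  contDiff_matrix_mul.comp_contDiffOn (hf.prodMk hg)

/-- Inversion of matrices is smooth. The norm on matrices in use is not submultiplicative, so the
statement is transported from the normed algebra of operators on Euclidean space. -/
theorem contDiffAt_matrix_inv {A : Matrix (Fin k) (Fin k) ℝ} (hA : IsUnit A) :
    ContDiffAt ℝ ∞ (fun B : Matrix (Fin k) (Fin k) ℝ => B⁻¹) A := by
  let e := (Matrix.toEuclideanCLM (n := Fin k) (𝕜 := ℝ)).toAlgEquiv
  let l : Matrix (Fin k) (Fin k) ℝ ≃L[ℝ]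
      (EuclideanSpace ℝ (Fin k) →L[ℝ] EuclideanSpace ℝ (Fin k)) :=
    e.toLinearEquiv.toContinuousLinearEquiv
  have h1 : (fun B : Matrix (Fin k) (Fin k) ℝ => B⁻¹) = fun B => l.symm (Ring.inverse (l B)) := by
    funext B
    rw [Matrix.nonsing_inv_eq_ringInverse]
    refine (l.symm_apply_eq.2 ?_).symm
    change Ring.inverse (e B) = e (Ring.inverse B)
    by_cases hB : IsUnit B
    · obtain ⟨u, rfl⟩ := hB
      rw [Ring.inverse_unit]
      exact Ring.inverse_unit (Units.map e.toMulEquiv.toMonoidHom u)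
    · rw [Ring.inverse_non_unit B hB, Ring.inverse_non_unit _ (mt (MulEquiv.isUnit_map e).1 hB),
        map_zero]
  rw [h1]
  obtain ⟨u, hu⟩ := hA.map e
  have h2 : ContDiffAt ℝ ∞ Ring.inverse (l A) := by
    change ContDiffAt ℝ ∞ Ring.inverse (e A)
    rw [← hu]
    exact contDiffAt_ringInverse ℝ u
  exact l.symm.contDiff.contDiffAt.comp A (h2.comp A l.contDiff.contDiffAt)

/-- The symmetric part `(A + Aᵀ) / 2` of a square matrix, as a linear projection onto the space of
symmetric matrices. -/
noncomputable def symPart (k : ℕ) : Matrix (Fin k) (Fin k) ℝ →L[ℝ] symMatrix k :=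
  LinearMap.toContinuousLinearMap
    { toFun := fun A => ⟨(2⁻¹ : ℝ) • (A + Aᵀ), by
        change ((2⁻¹ : ℝ) • (A + Aᵀ))ᵀ = _
        simp [add_comm]⟩
      map_add' := fun A B => Subtype.ext (by
        simp only [Matrix.transpose_add, Submodule.coe_add, ← smul_add]
        congr 1
        abel)
      map_smul' := fun c A => Subtype.ext (by
        simp [smul_smul, mul_comm]) }

theorem coe_symPart (A : Matrix (Fin k) (Fin k) ℝ) :
    (symPart k A : Matrix (Fin k) (Fin k) ℝ) = (2⁻¹ : ℝ) • (A + Aᵀ) := rfl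

theorem coe_symPart_of_transpose_eq {A : Matrix (Fin k) (Fin k) ℝ} (hA : Aᵀ = A) :
    (symPart k A : Matrix (Fin k) (Fin k) ℝ) = A := by
  rw [coe_symPart, hA, ← two_smul ℝ, smul_smul]
  norm_num

/-- A smooth inverse square root `r` near the identity: `(r T)ᵀ T (r T) = 1` for symmetric `T`. It
is the inverse of the local inverse at `1` of the squaring map on symmetric matrices, whose
derivative at `1` is multiplication by `2`; it is extended to all matrices through the symmetric
part. -/
theorem exists_contDiffOn_symm_sqrt (k : ℕ) :
    ∃ (r : Matrix (Fin k) (Fin k) ℝ → Matrix (Fin k) (Fin k) ℝ)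
      (N : Set (Matrix (Fin k) (Fin k) ℝ)),
      IsOpen N ∧ 1 ∈ N ∧ ContDiffOn ℝ ∞ r N ∧ r 1 = 1 ∧
        ∀ T ∈ N, Tᵀ = T → (r T)ᵀ * T * r T = 1 := by
  let sq : symMatrix k → symMatrix k := fun S => symPart k (S.1 * S.1)
  have hsq : ContDiff ℝ ∞ sq := by
    have h1 : ContDiff ℝ ∞ fun S : symMatrix k => (S : Matrix (Fin k) (Fin k) ℝ) :=
      (symMatrix k).subtypeL.contDiff
    exact (symPart k).contDiff.comp (contDiff_matrix_mul.comp (h1.prodMk h1))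
  let o : symMatrix k := ⟨1, Matrix.transpose_one⟩
  let D : symMatrix k ≃L[ℝ] symMatrix k :=
    ContinuousLinearEquiv.smulLeft (Units.mk0 (2 : ℝ) two_ne_zero)
  have hD : HasFDerivAt sq (D : symMatrix k →L[ℝ] symMatrix k) o := by
    have h1 := (symMatrix k).subtypeL.hasFDerivAt (x := o)
    have h2 := (matrixMulCLM k k k).hasFDerivAt_of_bilinear h1 h1
    have h3 := (symPart k).hasFDerivAt.comp o h2
    convert! h3 using 1
    ext H : 1
    apply Subtype.ext
    have hH : (H : Matrix (Fin k) (Fin k) ℝ)ᵀ = H := H.2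
    simp [coe_symPart, matrixMulCLM_apply, D, o, hH]
    module
  obtain ⟨e, hoe, -, hee, hes⟩ := ContDiffOn.exists_openPartialHomeomorph isOpen_univ
    hsq.contDiffOn (mem_univ o) hD
  have hso : sq o = o := Subtype.ext (by
    simp only [sq]
    rw [coe_symPart_of_transpose_eq] <;> simp [o])
  have heo : e o = o := by rw [hee, hso]
  have ho1 : symPart k 1 = o := Subtype.ext (coe_symPart_of_transpose_eq Matrix.transpose_one)
  have hso : e.symm o = o := by
    have := e.left_inv hoe
    rwa [heo] at this
  let g : Matrix (Fin k) (Fin k) ℝ → Matrix (Fin k) (Fin k) ℝ := fun T => e.symm (symPart k T)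
  let N₀ : Set (Matrix (Fin k) (Fin k) ℝ) := symPart k ⁻¹' e.target
  have hN₀ : IsOpen N₀ := e.open_target.preimage (symPart k).continuous
  have hg : ContDiffOn ℝ ∞ g N₀ := (symMatrix k).subtypeL.contDiff.comp_contDiffOn
    (hes.comp (symPart k).contDiff.contDiffOn fun T hT => hT)
  have hg1 : g 1 = 1 := by
    simp only [g, ho1, hso]
    rfl
  refine ⟨fun T => (g T)⁻¹, N₀ ∩ (fun T => (g T).det) ⁻¹' {0}ᶜ, ?_, ?_, ?_, ?_, ?_⟩
  · have : ContinuousOn (fun T => (g T).det) N₀ := by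
      have := hg.continuousOn
      exact (continuous_id.matrix_det :
        Continuous fun A : Matrix (Fin k) (Fin k) ℝ => A.det).comp_continuousOn this
    exact this.isOpen_inter_preimage hN₀ isOpen_compl_singleton
  · refine ⟨?_, ?_⟩
    · change symPart k 1 ∈ e.target
      rw [ho1, ← heo]
      exact e.map_source hoe
    · simp [hg1]
  · rintro T ⟨hT, hT'⟩
    have hu : IsUnit (g T) := (Matrix.isUnit_iff_isUnit_det _).2 (isUnit_iff_ne_zero.2 hT')
    exact (contDiffAt_matrix_inv hu).comp_contDiffWithinAt T ((hg T hT).mono inter_subset_left)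
  · simp [hg1]
  · rintro T ⟨hT, hT'⟩ hTt
    have hu : IsUnit (g T).det := isUnit_iff_ne_zero.2 hT'
    have hgt : (g T)ᵀ = g T := (e.symm (symPart k T)).2
    have hgg : g T * g T = T := by
      have h1 : sq (e.symm (symPart k T)) = symPart k T := by
        rw [← hee]; exact e.right_inv hT
      have h2 := congrArg Subtype.val h1
      rw [coe_symPart_of_transpose_eq hTt] at h2
      refine ((coe_symPart_of_transpose_eq ?_).symm.trans h2 :)
      rw [Matrix.transpose_mul]
      change (g T)ᵀ * (g T)ᵀ = g T * g T
      rw [hgt]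
    change ((g T)⁻¹)ᵀ * T * (g T)⁻¹ = 1
    rw [Matrix.transpose_nonsing_inv, hgt]
    nth_rw 2 [← hgg]
    rw [← Matrix.mul_assoc, Matrix.nonsing_inv_mul _ hu, Matrix.one_mul,
      Matrix.mul_nonsing_inv _ hu]

/-- The polar retraction `X ↦ X (XᵀX)^{-1/2}` onto the Stiefel manifold: it is smooth near the
Stiefel manifold, fixes its points, and does not enlarge the column space. -/
theorem exists_orthonormalization (n k : ℕ) :
    ∃ (o : Matrix (Fin n) (Fin k) ℝ → Matrix (Fin n) (Fin k) ℝ)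
      (O : Set (Matrix (Fin n) (Fin k) ℝ)),
      IsOpen O ∧ stiefel n k ⊆ O ∧ ContDiffOn ℝ ∞ o O ∧ (∀ Q ∈ stiefel n k, o Q = Q) ∧
        ∀ X ∈ O, o X ∈ stiefel n k ∧ ∃ R, o X = X * R := by
  obtain ⟨r, N, hN, h1N, hr, hr1, hrT⟩ := exists_contDiffOn_symm_sqrt k
  have hs : ContDiff ℝ ∞ fun X : Matrix (Fin n) (Fin k) ℝ => Xᵀ * X :=
    contDiff_matrix_mul.comp (contDiff_matrix_transpose.prodMk contDiff_id)
  refine ⟨fun X => X * r (Xᵀ * X), (fun X => Xᵀ * X) ⁻¹' N, hN.preimage hs.continuous,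
    ?_, ?_, ?_, ?_⟩
  · intro Q hQ
    have hQ : Qᵀ * Q = 1 := hQ
    simpa [hQ] using h1N
  · exact contDiffOn_id.matrix_mul (hr.comp hs.contDiffOn fun X hX => hX)
  · intro Q hQ
    have hQ : Qᵀ * Q = 1 := hQ
    simp [hQ, hr1]
  · intro X hX
    refine ⟨?_, _, rfl⟩
    change (X * r (Xᵀ * X))ᵀ * (X * r (Xᵀ * X)) = 1
    have := hrT _ hX (by simp)
    rw [← this, Matrix.transpose_mul]
    simp only [Matrix.mul_assoc]

end MatrixCalculus

/-! ### Frames, subspaces and positive semidefinite matrices -/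

section MatrixAlgebra

variable {m n k : ℕ}

open scoped MatrixOrder in
theorem Matrix.PosDef.exists_eq_transpose_mul_self {S : Matrix (Fin k) (Fin k) ℝ} (hS : S.PosDef) :
    ∃ C : Matrix (Fin k) (Fin k) ℝ, IsUnit C ∧ S = Cᵀ * C := by
  obtain ⟨C, hC⟩ := CStarAlgebra.nonneg_iff_eq_star_mul_self.mp hS.posSemidef.nonneg
  rw [Matrix.star_eq_conjTranspose, Matrix.conjTranspose_eq_transpose_of_trivial] at hC
  refine ⟨C, ?_, hC⟩
  rw [Matrix.isUnit_iff_isUnit_det]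
  have h := (Matrix.isUnit_iff_isUnit_det _).1 hS.isUnit
  rw [hC, Matrix.det_mul] at h
  exact isUnit_of_mul_isUnit_right h

theorem Matrix.range_mulVecLin_mul_le {l : ℕ} (A : Matrix (Fin l) (Fin m) ℝ)
    (B : Matrix (Fin m) (Fin n) ℝ) :
    LinearMap.range (A * B).mulVecLin ≤ LinearMap.range A.mulVecLin := by
  rw [Matrix.mulVecLin_mul]
  exact LinearMap.range_comp_le_range _ _

theorem Matrix.eq_zero_of_forall_mulVec {A : Matrix (Fin m) (Fin n) ℝ}
    (h : ∀ v, A *ᵥ v = 0) : A = 0 := by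
  ext i j
  have := congrFun (h (Pi.single j 1)) i
  simpa using this

/-- `Q Qᵀ` fixes the matrices whose columns lie in the span of the orthonormal columns of `Q`. -/
theorem mul_transpose_mul_eq_self {Q : Matrix (Fin n) (Fin k) ℝ} (hQ : Q ∈ stiefel n k)
    {A : Matrix (Fin n) (Fin m) ℝ}
    (h : LinearMap.range A.mulVecLin ≤ LinearMap.range Q.mulVecLin) : Q * Qᵀ * A = A := by
  have hQ : Qᵀ * Q = 1 := hQ
  rw [← sub_eq_zero]
  refine Matrix.eq_zero_of_forall_mulVec fun v => ?_
  obtain ⟨w, hw⟩ := h ⟨v, rfl⟩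
  have hw : Q *ᵥ w = A *ᵥ v := hw
  rw [Matrix.sub_mulVec, ← Matrix.mulVec_mulVec, ← hw, Matrix.mulVec_mulVec, Matrix.mul_assoc, hQ,
    Matrix.mul_one, sub_self]

theorem finrank_range_of_mem_stiefel {Q : Matrix (Fin n) (Fin k) ℝ} (hQ : Q ∈ stiefel n k) :
    Module.finrank ℝ (LinearMap.range Q.mulVecLin) = k :=
  (grProj ⟨Q, hQ⟩).2

theorem grProj_eq_of_le {Q : stiefel n k} {P : Gr k n}
    (h : LinearMap.range Q.1.mulVecLin ≤ P.1) : grProj Q = P :=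
  Subtype.ext (Submodule.eq_of_le_of_finrank_eq h (by
    rw [P.2]; exact finrank_range_of_mem_stiefel Q.2))

/-- Every subspace has an orthonormal frame: a basis `B` is corrected by a factorization of its Gram
matrix `Bᵀ B = Cᵀ C` into `B C⁻¹`. -/
theorem exists_range_eq_stiefel (P : Submodule ℝ (Fin n → ℝ)) (hP : Module.finrank ℝ P = k) :
    ∃ Q ∈ stiefel n k, LinearMap.range (Q : Matrix (Fin n) (Fin k) ℝ).mulVecLin = P := by
  let b : Module.Basis (Fin k) ℝ P := (Module.finBasisOfFinrankEq ℝ P hP)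
  let B : Matrix (Fin n) (Fin k) ℝ := Matrix.of fun i j => (b j : Fin n → ℝ) i
  have hcol : B.col = fun j => (b j : Fin n → ℝ) := rfl
  have hB : Function.Injective B.mulVec := by
    rw [Matrix.mulVec_injective_iff, hcol]
    exact b.linearIndependent.map' P.subtype (Submodule.ker_subtype P)
  have hBP : LinearMap.range B.mulVecLin ≤ P := by
    rw [Matrix.range_mulVecLin, hcol, Submodule.span_le]
    rintro _ ⟨j, rfl⟩
    exact (b j).2
  have hpd : (Bᵀ * B).PosDef := by
    have := Matrix.PosDef.conjTranspose_mul_self B hB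
    rwa [Matrix.conjTranspose_eq_transpose_of_trivial] at this
  obtain ⟨C, hC, hBC⟩ := hpd.exists_eq_transpose_mul_self
  have hCd : IsUnit C.det := (Matrix.isUnit_iff_isUnit_det _).1 hC
  have hQ : B * C⁻¹ ∈ stiefel n k := by
    change (B * C⁻¹)ᵀ * (B * C⁻¹) = 1
    rw [Matrix.transpose_mul, Matrix.mul_assoc, ← Matrix.mul_assoc Bᵀ, hBC, Matrix.mul_assoc,
      Matrix.mul_nonsing_inv _ hCd, Matrix.mul_one, ← Matrix.transpose_mul,
      Matrix.mul_nonsing_inv _ hCd, Matrix.transpose_one]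
  refine ⟨_, hQ, ?_⟩
  refine Submodule.eq_of_le_of_finrank_eq ((Matrix.range_mulVecLin_mul_le _ _).trans hBP) ?_
  rw [hP, finrank_range_of_mem_stiefel hQ]

theorem grProj_surjective : Function.Surjective (grProj (n := n) (k := k)) := by
  intro P
  obtain ⟨Q, hQ, h⟩ := exists_range_eq_stiefel P.1 P.2
  exact ⟨⟨Q, hQ⟩, Subtype.ext h⟩

/-- `Q Qᵀ`, the orthogonal projection onto the span of `Q`, depends on that span only. -/
theorem mul_transpose_eq_of_grProj_eq {Q Q' : stiefel n k} (h : grProj Q = grProj Q') :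
    Q.1 * Q.1ᵀ = Q'.1 * Q'.1ᵀ := by
  have h : LinearMap.range Q.1.mulVecLin = LinearMap.range Q'.1.mulVecLin := congrArg Subtype.val h
  have h1 : Q.1 * Q.1ᵀ * Q'.1 = Q'.1 := mul_transpose_mul_eq_self Q.2 h.ge
  have h2 : Q'.1 * Q'.1ᵀ * Q.1 = Q.1 := mul_transpose_mul_eq_self Q'.2 h.le
  calc Q.1 * Q.1ᵀ = Q.1 * (Q'.1 * Q'.1ᵀ * Q.1)ᵀ := by rw [h2]
    _ = Q.1 * Q.1ᵀ * Q'.1 * Q'.1ᵀ := by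
      simp only [Matrix.transpose_mul, Matrix.transpose_transpose, Matrix.mul_assoc]
    _ = Q'.1 * Q'.1ᵀ := by rw [h1]

/-- Two orthonormal bases of the same subspace differ by an orthogonal matrix. -/
theorem exists_orthogonal_of_grProj_eq {Q Q' : stiefel n k} (h : grProj Q = grProj Q') :
    ∃ G ∈ Matrix.orthogonalGroup (Fin k) ℝ, Q'.1 = Q.1 * G := by
  have h0 : LinearMap.range Q.1.mulVecLin = LinearMap.range Q'.1.mulVecLin :=
    congrArg Subtype.val h
  have h1 : Q.1 * Q.1ᵀ * Q'.1 = Q'.1 := mul_transpose_mul_eq_self Q.2 h0.ge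
  have hQ' : Q'.1ᵀ * Q'.1 = 1 := Q'.2
  refine ⟨Q.1ᵀ * Q'.1, ?_, by rw [← Matrix.mul_assoc, h1]⟩
  rw [Matrix.mem_orthogonalGroup_iff', Matrix.transpose_mul, Matrix.transpose_transpose,
    Matrix.mul_assoc, ← Matrix.mul_assoc Q.1, h1, hQ']

/-- The matrix of the orthogonal projection onto a subspace. -/
noncomputable def grMatrix (P : Gr k n) : Matrix (Fin n) (Fin n) ℝ :=
  (grProj_surjective P).choose.1 * (grProj_surjective P).choose.1ᵀ

theorem grMatrix_grProj (Q : stiefel n k) : grMatrix (grProj Q) = Q.1 * Q.1ᵀ :=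
  mul_transpose_eq_of_grProj_eq (grProj_surjective (grProj Q)).choose_spec

theorem range_grMatrix (P : Gr k n) : LinearMap.range (grMatrix P).mulVecLin = P.1 := by
  obtain ⟨Q, rfl⟩ := grProj_surjective P
  have hQ : Q.1ᵀ * Q.1 = 1 := Q.2
  rw [grMatrix_grProj]
  refine le_antisymm (Matrix.range_mulVecLin_mul_le _ _) ?_
  have := Matrix.range_mulVecLin_mul_le (Q.1 * Q.1ᵀ) Q.1
  rwa [Matrix.mul_assoc, hQ, Matrix.mul_one] at this

theorem grMatrix_injective : Function.Injective (grMatrix (n := n) (k := k)) := fun P P' h =>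
  Subtype.ext (by rw [← range_grMatrix, ← range_grMatrix, h])

theorem range_grMatrix_eq : range (grMatrix (n := n) (k := k)) =
    (fun Q => Q * Qᵀ) '' stiefel n k := by
  ext A
  constructor
  · rintro ⟨P, rfl⟩
    obtain ⟨Q, rfl⟩ := grProj_surjective P
    exact ⟨Q.1, Q.2, (grMatrix_grProj Q).symm⟩
  · rintro ⟨Q, hQ, rfl⟩
    exact ⟨grProj ⟨Q, hQ⟩, grMatrix_grProj _⟩

theorem transpose_eq_of_mem_symRank {A : Matrix (Fin n) (Fin n) ℝ} (hA : A ∈ symRank n k) :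
    Aᵀ = A := by
  have := hA.1.isHermitian
  rwa [Matrix.IsHermitian, Matrix.conjTranspose_eq_transpose_of_trivial] at this

theorem range_mul_mul_transpose {Q : Matrix (Fin n) (Fin k) ℝ} (hQ : Q ∈ stiefel n k)
    {S : Matrix (Fin k) (Fin k) ℝ} (hS : IsUnit S) :
    LinearMap.range (Q * S * Qᵀ).mulVecLin = LinearMap.range Q.mulVecLin := by
  have hQ : Qᵀ * Q = 1 := hQ
  refine le_antisymm ?_ ?_
  · rw [Matrix.mul_assoc]
    exact Matrix.range_mulVecLin_mul_le _ _
  · have := Matrix.range_mulVecLin_mul_le (Q * S * Qᵀ) (Q * S⁻¹)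
    rwa [Matrix.mul_assoc, ← Matrix.mul_assoc Qᵀ, hQ, Matrix.one_mul, Matrix.mul_assoc,
      Matrix.mul_nonsing_inv _ ((Matrix.isUnit_iff_isUnit_det _).1 hS), Matrix.mul_one] at this

theorem mul_mul_transpose_mem_symRank {Q : Matrix (Fin n) (Fin k) ℝ} (hQ : Q ∈ stiefel n k)
    {S : Matrix (Fin k) (Fin k) ℝ} (hS : S.PosDef) : Q * S * Qᵀ ∈ symRank n k := by
  refine ⟨?_, ?_⟩
  · have := hS.posSemidef.mul_mul_conjTranspose_same Q
    rwa [Matrix.conjTranspose_eq_transpose_of_trivial] at this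
  · rw [Matrix.rank, range_mul_mul_transpose hQ hS.isUnit]
    exact finrank_range_of_mem_stiefel hQ

/-- If `Q` is an orthonormal frame of the image of `A`, then `A` is recovered from its compression
`Qᵀ A Q`. -/
theorem mul_transpose_mul_mul_of_symProj_eq {A : symRank n k} {Q : stiefel n k}
    (h : symProj A = grProj Q) : Q.1 * (Q.1ᵀ * A.1 * Q.1) * Q.1ᵀ = A.1 := by
  have h0 : LinearMap.range A.1.mulVecLin = LinearMap.range Q.1.mulVecLin :=
    congrArg Subtype.val h
  have h1 : Q.1 * Q.1ᵀ * A.1 = A.1 := mul_transpose_mul_eq_self Q.2 h0.le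
  have h2 : A.1 * (Q.1 * Q.1ᵀ) = A.1 := by
    have := congrArg Matrix.transpose h1
    rwa [Matrix.transpose_mul, Matrix.transpose_mul, Matrix.transpose_transpose,
      transpose_eq_of_mem_symRank A.2] at this
  calc Q.1 * (Q.1ᵀ * A.1 * Q.1) * Q.1ᵀ = Q.1 * Q.1ᵀ * (A.1 * (Q.1 * Q.1ᵀ)) := by
        simp only [Matrix.mul_assoc]
    _ = A.1 := by rw [h2, h1]

/-- If `Q` is an orthonormal frame of the image of `A`, then the compression `Qᵀ A Q` is positive
definite: it is positive semidefinite, and its rank is that of `A`. -/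
theorem posDef_transpose_mul_mul_of_symProj_eq {A : symRank n k} {Q : stiefel n k}
    (h : symProj A = grProj Q) : (Q.1ᵀ * A.1 * Q.1).PosDef := by
  have hps : (Q.1ᵀ * A.1 * Q.1).PosSemidef := by
    have := A.2.1.conjTranspose_mul_mul_same Q.1
    rwa [Matrix.conjTranspose_eq_transpose_of_trivial] at this
  rw [hps.posDef_iff_isUnit]
  have h1 := mul_transpose_mul_mul_of_symProj_eq h
  have h2 : k ≤ (Q.1ᵀ * A.1 * Q.1).rank := by
    calc k = (Q.1 * (Q.1ᵀ * A.1 * Q.1) * Q.1ᵀ).rank := by rw [h1]; exact A.2.2.symm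
      _ ≤ (Q.1 * (Q.1ᵀ * A.1 * Q.1)).rank := Matrix.rank_mul_le_left _ _
      _ ≤ _ := Matrix.rank_mul_le_right _ _
  rw [← Matrix.mulVec_injective_iff_isUnit]
  have h3 : LinearMap.range (Q.1ᵀ * A.1 * Q.1).mulVecLin = ⊤ :=
    Submodule.eq_top_of_finrank_eq (le_antisymm (Submodule.finrank_le _)
      (by rw [Module.finrank_fin_fun]; exact h2))
  exact LinearMap.injective_iff_surjective.2 (LinearMap.range_eq_top.1 h3)

/-- The map `[Q, S] ↦ Q S Qᵀ`, with values in the space of matrices. -/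
def assocMatrix : AssocBundle n k → Matrix (Fin n) (Fin n) ℝ :=
  Quotient.lift (fun p : stiefel n k × symPos k => p.1.1 * p.2.1.1 * p.1.1ᵀ) (by
    rintro p q ⟨G, hG, h1, h2⟩
    have hG1 : G * Gᵀ = 1 := Matrix.mem_orthogonalGroup_iff (Fin k) ℝ |>.mp hG
    change p.1.1 * p.2.1.1 * p.1.1ᵀ = q.1.1 * q.2.1.1 * q.1.1ᵀ
    rw [h1, h2, Matrix.transpose_mul]
    calc p.1.1 * p.2.1.1 * p.1.1ᵀ
        = p.1.1 * (G * Gᵀ) * p.2.1.1 * (G * Gᵀ) * p.1.1ᵀ := by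
          rw [hG1, Matrix.mul_one, Matrix.mul_one]
      _ = _ := by simp only [Matrix.mul_assoc])

theorem assocMatrix_mk (Q : stiefel n k) (S : symPos k) :
    assocMatrix (assocMk (Q, S)) = Q.1 * S.1.1 * Q.1ᵀ := rfl

theorem assocMk_surjective : Function.Surjective (assocMk (n := n) (k := k)) :=
  Quotient.mk_surjective

theorem symPos_posDef (S : symPos k) : S.1.1.PosDef := S.2

/-- The map `[Q, S] ↦ Q S Qᵀ` into the positive semidefinite matrices of rank `k`. -/
def assocToSym (x : AssocBundle n k) : symRank n k :=
  ⟨assocMatrix x, by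
    obtain ⟨⟨Q, S⟩, rfl⟩ := assocMk_surjective x
    exact mul_mul_transpose_mem_symRank Q.2 S.2⟩

theorem symProj_assocToSym (x : AssocBundle n k) : symProj (assocToSym x) = assocProj x := by
  obtain ⟨⟨Q, S⟩, rfl⟩ := assocMk_surjective x
  exact Subtype.ext (range_mul_mul_transpose Q.2 (symPos_posDef S).isUnit)

/-- If `Q S Qᵀ = Q' S' Q'ᵀ`, then `Q` and `Q'` span the image of this matrix, so `Q' = Q G` with `G`
orthogonal, and `G` also relates `S` to `S'`. -/
theorem assocToSym_injective : Function.Injective (assocToSym (n := n) (k := k)) := by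
  intro x y hxy
  have hp : assocProj x = assocProj y := by
    rw [← symProj_assocToSym, ← symProj_assocToSym, hxy]
  obtain ⟨⟨Q, S⟩, rfl⟩ := assocMk_surjective x
  obtain ⟨⟨Q', S'⟩, rfl⟩ := assocMk_surjective y
  obtain ⟨G, hG, hQG⟩ := exists_orthogonal_of_grProj_eq hp
  have hG2 : Gᵀ * G = 1 := Matrix.mem_orthogonalGroup_iff' (Fin k) ℝ |>.mp hG
  have hQ : Q.1ᵀ * Q.1 = 1 := Q.2
  have h1 : Q.1 * S.1.1 * Q.1ᵀ = Q.1 * G * S'.1.1 * (Q.1 * G)ᵀ := by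
    rw [← hQG]; exact congrArg Subtype.val hxy
  have h2 : S.1.1 = G * S'.1.1 * Gᵀ := by
    calc S.1.1 = Q.1ᵀ * Q.1 * S.1.1 * (Q.1ᵀ * Q.1) := by simp [hQ]
      _ = Q.1ᵀ * (Q.1 * S.1.1 * Q.1ᵀ) * Q.1 := by simp only [Matrix.mul_assoc]
      _ = Q.1ᵀ * Q.1 * G * S'.1.1 * Gᵀ * (Q.1ᵀ * Q.1) := by
        rw [h1, Matrix.transpose_mul]; simp only [Matrix.mul_assoc]
      _ = _ := by simp [hQ]
  refine Quotient.sound ⟨G, hG, hQG, ?_⟩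
  change S'.1.1 = Gᵀ * S.1.1 * G
  calc S'.1.1 = Gᵀ * G * S'.1.1 * (Gᵀ * G) := by simp [hG2]
    _ = Gᵀ * (G * S'.1.1 * Gᵀ) * G := by simp only [Matrix.mul_assoc]
    _ = _ := by rw [← h2]

theorem assocToSym_mk_eq {A : symRank n k} {Q : stiefel n k} {S : symPos k}
    (h : symProj A = grProj Q) (hS : S.1.1 = Q.1ᵀ * A.1 * Q.1) :
    assocToSym (assocMk (Q, S)) = A :=
  Subtype.ext (by
    change Q.1 * S.1.1 * Q.1ᵀ = A.1
    rw [hS, mul_transpose_mul_mul_of_symProj_eq h])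

theorem transpose_conj_of_mem_symRank {A : symRank n k} (Q : Matrix (Fin n) (Fin k) ℝ) :
    (Qᵀ * A.1 * Q)ᵀ = Qᵀ * A.1 * Q := by
  rw [Matrix.transpose_mul, Matrix.transpose_mul, Matrix.transpose_transpose,
    transpose_eq_of_mem_symRank A.2, Matrix.mul_assoc]

theorem assocToSym_surjective : Function.Surjective (assocToSym (n := n) (k := k)) := by
  intro A
  obtain ⟨Q, hQ⟩ := grProj_surjective (symProj A)
  exact ⟨assocMk (Q, ⟨⟨_, transpose_conj_of_mem_symRank Q.1⟩,
    posDef_transpose_mul_mul_of_symProj_eq hQ.symm⟩), assocToSym_mk_eq hQ.symm rfl⟩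

/-- An orthonormal frame of a subspace is completed by one of its orthogonal complement, which is
the kernel of `Qᵀ`. -/
theorem exists_stiefel_compl {Q : Matrix (Fin n) (Fin k) ℝ} (hQ : Q ∈ stiefel n k) :
    ∃ N ∈ stiefel n (n - k), Qᵀ * N = 0 ∧ Q * Qᵀ + N * Nᵀ = 1 := by
  have hQ1 : Qᵀ * Q = 1 := hQ
  have hd : Module.finrank ℝ (LinearMap.ker Qᵀ.mulVecLin) = n - k := by
    have h1 := LinearMap.finrank_range_add_finrank_ker Qᵀ.mulVecLin
    have h2 : Module.finrank ℝ (LinearMap.range Qᵀ.mulVecLin) = k := by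
      change Qᵀ.rank = k
      rw [Matrix.rank_transpose]
      exact finrank_range_of_mem_stiefel hQ
    rw [h2, Module.finrank_fin_fun] at h1
    omega
  obtain ⟨N, hN, hr⟩ := exists_range_eq_stiefel _ hd
  have hQN : Qᵀ * N = 0 := by
    refine Matrix.eq_zero_of_forall_mulVec fun v => ?_
    have : N.mulVecLin v ∈ LinearMap.ker Qᵀ.mulVecLin := hr ▸ ⟨v, rfl⟩
    rw [← Matrix.mulVec_mulVec]
    exact this
  refine ⟨N, hN, hQN, ?_⟩
  have h1 : N * Nᵀ * (1 - Q * Qᵀ) = 1 - Q * Qᵀ := by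
    refine mul_transpose_mul_eq_self hN ?_
    rw [hr]
    rintro _ ⟨v, rfl⟩
    change Qᵀ *ᵥ ((1 - Q * Qᵀ) *ᵥ v) = 0
    rw [Matrix.mulVec_mulVec, Matrix.mul_sub, ← Matrix.mul_assoc, hQ1]
    simp
  have hNQ : Nᵀ * Q = 0 := by
    have := congrArg Matrix.transpose hQN
    simpa using this
  rw [Matrix.mul_sub, Matrix.mul_one, Matrix.mul_assoc, ← Matrix.mul_assoc Nᵀ, hNQ,
    Matrix.zero_mul, Matrix.mul_zero, sub_zero] at h1
  rw [h1]
  abel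

/-- `O(n)` acts transitively on the Stiefel manifold: completions `(Q, N)` and `(Q', N')` to
orthonormal bases give `U = Q' Qᵀ + N' Nᵀ`. -/
theorem exists_orthogonal_mul_eq {Q Q' : Matrix (Fin n) (Fin k) ℝ} (hQ : Q ∈ stiefel n k)
    (hQ' : Q' ∈ stiefel n k) :
    ∃ U : Matrix (Fin n) (Fin n) ℝ, Uᵀ * U = 1 ∧ U * Uᵀ = 1 ∧ U * Q = Q' := by
  obtain ⟨N, hN, hQN, h1⟩ := exists_stiefel_compl hQ
  obtain ⟨N', hN', hQN', -⟩ := exists_stiefel_compl hQ'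
  have hQ1 : Qᵀ * Q = 1 := hQ
  have hQ1' : Q'ᵀ * Q' = 1 := hQ'
  have hN1 : N'ᵀ * N' = 1 := hN'
  have hNQ : Nᵀ * Q = 0 := by simpa using congrArg Matrix.transpose hQN
  have hNQ' : N'ᵀ * Q' = 0 := by simpa using congrArg Matrix.transpose hQN'
  have hU : (Q' * Qᵀ + N' * Nᵀ)ᵀ * (Q' * Qᵀ + N' * Nᵀ) = 1 := by
    calc (Q' * Qᵀ + N' * Nᵀ)ᵀ * (Q' * Qᵀ + N' * Nᵀ)
        = Q * (Q'ᵀ * Q') * Qᵀ + Q * (Q'ᵀ * N') * Nᵀ + N * (N'ᵀ * Q') * Qᵀ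
          + N * (N'ᵀ * N') * Nᵀ := by
          simp only [Matrix.transpose_add, Matrix.transpose_mul, Matrix.transpose_transpose,
            Matrix.add_mul, Matrix.mul_add, Matrix.mul_assoc]
          abel
      _ = 1 := by simp [hQ1', hQN', hNQ', hN1, h1]
  refine ⟨Q' * Qᵀ + N' * Nᵀ, hU, mul_eq_one_comm.1 hU, ?_⟩
  rw [Matrix.add_mul, Matrix.mul_assoc, hQ1, Matrix.mul_assoc, hNQ]
  simp

end MatrixAlgebra

/-! ### Smooth local sections -/

section LocalSections

variable {l m n k : ℕ}

/-- The open set of matrices on which `orth` is defined. -/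
noncomputable def orthDomain (n k : ℕ) : Set (Matrix (Fin n) (Fin k) ℝ) :=
  (exists_orthonormalization n k).choose_spec.choose

/-- A smooth orthonormalization of the columns of a matrix, on a neighbourhood `orthDomain` of the
Stiefel manifold. -/
noncomputable def orth (n k : ℕ) : Matrix (Fin n) (Fin k) ℝ → Matrix (Fin n) (Fin k) ℝ :=
  (exists_orthonormalization n k).choose

theorem orth_spec (n k : ℕ) : IsOpen (orthDomain n k) ∧ stiefel n k ⊆ orthDomain n k ∧
    ContDiffOn ℝ ∞ (orth n k) (orthDomain n k) ∧ (∀ Q ∈ stiefel n k, orth n k Q = Q) ∧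
      ∀ X ∈ orthDomain n k, orth n k X ∈ stiefel n k ∧ ∃ R, orth n k X = X * R :=
  (exists_orthonormalization n k).choose_spec.choose_spec

open Classical in
/-- `orth` as a map to the Stiefel manifold, with value `Q₀` outside its domain. -/
noncomputable def orthStiefel (Q₀ : stiefel n k) (X : Matrix (Fin n) (Fin k) ℝ) : stiefel n k :=
  if h : X ∈ orthDomain n k then ⟨orth n k X, ((orth_spec n k).2.2.2.2 X h).1⟩ else Q₀

theorem coe_orthStiefel (Q₀ : stiefel n k) {X : Matrix (Fin n) (Fin k) ℝ}
    (h : X ∈ orthDomain n k) : (orthStiefel Q₀ X).1 = orth n k X := by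
  rw [orthStiefel, dif_pos h]

theorem mem_orthDomain (Q : stiefel n k) : Q.1 ∈ orthDomain n k := (orth_spec n k).2.1 Q.2

theorem orthStiefel_coe (Q₀ Q : stiefel n k) : orthStiefel Q₀ Q.1 = Q :=
  Subtype.ext (by rw [coe_orthStiefel _ (mem_orthDomain Q), (orth_spec n k).2.2.2.1 Q.1 Q.2])

/-- If the columns of `X` lie in a `k`-dimensional subspace and can be orthonormalized, they span
it. -/
theorem grProj_orthStiefel (Q₀ : stiefel n k) {X : Matrix (Fin n) (Fin k) ℝ}
    (hX : X ∈ orthDomain n k) {P : Gr k n} (h : LinearMap.range X.mulVecLin ≤ P.1) :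
    grProj (orthStiefel Q₀ X) = P := by
  refine grProj_eq_of_le ?_
  obtain ⟨R, hR⟩ := ((orth_spec n k).2.2.2.2 X hX).2
  rw [coe_orthStiefel Q₀ hX, hR]
  exact (Matrix.range_mulVecLin_mul_le X R).trans h

theorem orthDomain_mem_nhds {X : Matrix (Fin n) (Fin k) ℝ} (hX : X ∈ orthDomain n k) :
    orthDomain n k ∈ 𝓝 X := (orth_spec n k).1.mem_nhds hX

theorem contDiffAt_coe_orthStiefel (Q₀ : stiefel n k) {X : Matrix (Fin n) (Fin k) ℝ}
    (hX : X ∈ orthDomain n k) : ContDiffAt ℝ ∞ (fun Y => (orthStiefel Q₀ Y).1) X := by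
  refine ((orth_spec n k).2.2.1.contDiffAt (orthDomain_mem_nhds hX)).congr_of_eventuallyEq ?_
  filter_upwards [orthDomain_mem_nhds hX] with Y hY using coe_orthStiefel Q₀ hY

open Classical in
/-- The symmetric part of a matrix as a positive definite matrix, with value `1` if it is not
positive definite. -/
noncomputable def toSymPos (A : Matrix (Fin k) (Fin k) ℝ) : symPos k :=
  if h : (symPart k A).1.PosDef then ⟨symPart k A, h⟩
  else ⟨⟨1, Matrix.transpose_one⟩, Matrix.PosDef.one⟩

theorem coe_toSymPos {A : Matrix (Fin k) (Fin k) ℝ} (h : (symPart k A).1.PosDef) :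
    (toSymPos A : symMatrix k) = symPart k A := by
  rw [toSymPos, dif_pos h]

theorem symPart_eq {A : Matrix (Fin k) (Fin k) ℝ} (h : A.PosDef) : (symPart k A).1 = A := by
  refine coe_symPart_of_transpose_eq ?_
  have := h.isHermitian
  rwa [Matrix.IsHermitian, Matrix.conjTranspose_eq_transpose_of_trivial] at this

theorem coe_toSymPos_of_posDef {A : Matrix (Fin k) (Fin k) ℝ} (h : A.PosDef) :
    (toSymPos A).1.1 = A := by
  rw [coe_toSymPos (by rwa [symPart_eq h]), symPart_eq h]

theorem toSymPos_coe (S : symPos k) : toSymPos S.1.1 = S :=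
  Subtype.ext (Subtype.ext (coe_toSymPos_of_posDef S.2))

theorem isOpen_posDef_symPart : IsOpen {A : Matrix (Fin k) (Fin k) ℝ | (symPart k A).1.PosDef} :=
  (isOpen_posDef k).preimage (symPart k).continuous

theorem contDiffAt_coe_toSymPos {A : Matrix (Fin k) (Fin k) ℝ} (h : (symPart k A).1.PosDef) :
    ContDiffAt ℝ ∞ (fun B => (toSymPos B : symMatrix k)) A := by
  refine (symPart k).contDiff.contDiffAt.congr_of_eventuallyEq ?_
  filter_upwards [isOpen_posDef_symPart.mem_nhds h] with B hB using coe_toSymPos hB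

theorem contMDiffAt_toSymPos {A : Matrix (Fin k) (Fin k) ℝ} (h : (symPart k A).1.PosDef) :
    ContMDiffAt 𝓘(ℝ, Matrix (Fin k) (Fin k) ℝ) 𝓘(ℝ, symMatrix k) ∞ toSymPos A :=
  (IsSmoothEmbedding.of_opens (symPos k)).contMDiffAt_of_comp
    (contDiffAt_coe_toSymPos h).contMDiffAt

/-- The Stiefel frame that a matrix `Y` near `Q₀ S₀ Q₀ᵀ` determines: an orthonormalization of
`Y Q₀ S₀⁻¹`, which is `Q₀` itself for `Y = Q₀ S₀ Q₀ᵀ`. If `Y` has rank `k`, the frame spans the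
image of `Y`. -/
noncomputable def symFrame (Q₀ : stiefel n k) (S₀ : symPos k) (Y : Matrix (Fin n) (Fin n) ℝ) :
    stiefel n k := orthStiefel Q₀ (Y * (Q₀.1 * S₀.1.1⁻¹))

/-- A local section through `(Q₀, S₀)` of the map `(Q, S) ↦ Q S Qᵀ`. -/
noncomputable def symSection (Q₀ : stiefel n k) (S₀ : symPos k) (Y : Matrix (Fin n) (Fin n) ℝ) :
    stiefel n k × symPos k :=
  (symFrame Q₀ S₀ Y, toSymPos ((symFrame Q₀ S₀ Y).1ᵀ * Y * (symFrame Q₀ S₀ Y).1))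

/-- The open set of matrices `Y` on which `symSection` is smooth: those for which the
orthonormalization is defined and the compression of `Y` is positive definite. -/
def symSectionDomain (Q₀ : stiefel n k) (S₀ : symPos k) : Set (Matrix (Fin n) (Fin n) ℝ) :=
  {Y | Y * (Q₀.1 * S₀.1.1⁻¹) ∈ orthDomain n k ∧
    (symPart k ((symFrame Q₀ S₀ Y).1ᵀ * Y * (symFrame Q₀ S₀ Y).1)).1.PosDef}

theorem symProj_eq_grProj_symFrame (Q₀ : stiefel n k) (S₀ : symPos k) {A : symRank n k}
    (hA : A.1 * (Q₀.1 * S₀.1.1⁻¹) ∈ orthDomain n k) :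
    symProj A = grProj (symFrame Q₀ S₀ A.1) :=
  (grProj_orthStiefel Q₀ hA (Matrix.range_mulVecLin_mul_le _ _)).symm

/-- On matrices of `Sym(n,k)` the positivity condition of `symSectionDomain` is automatic. -/
theorem mem_symSectionDomain {Q₀ : stiefel n k} {S₀ : symPos k} {A : symRank n k}
    (hA : A.1 * (Q₀.1 * S₀.1.1⁻¹) ∈ orthDomain n k) : A.1 ∈ symSectionDomain Q₀ S₀ := by
  have h := posDef_transpose_mul_mul_of_symProj_eq (symProj_eq_grProj_symFrame Q₀ S₀ hA)
  exact ⟨hA, by rwa [symPart_eq h]⟩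

theorem assocToSym_symSection {Q₀ : stiefel n k} {S₀ : symPos k} {A : symRank n k}
    (hA : A.1 ∈ symSectionDomain Q₀ S₀) : assocToSym (assocMk (symSection Q₀ S₀ A.1)) = A := by
  have h := symProj_eq_grProj_symFrame Q₀ S₀ hA.1
  exact assocToSym_mk_eq h (coe_toSymPos_of_posDef (posDef_transpose_mul_mul_of_symProj_eq h))

theorem assocMatrix_assocMk_mul (Q₀ : stiefel n k) (S₀ : symPos k) :
    assocMatrix (assocMk (Q₀, S₀)) * (Q₀.1 * S₀.1.1⁻¹) = Q₀.1 := by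
  have hQ : Q₀.1ᵀ * Q₀.1 = 1 := Q₀.2
  have hS := (Matrix.isUnit_iff_isUnit_det _).1 (symPos_posDef S₀).isUnit
  rw [assocMatrix_mk, Matrix.mul_assoc, ← Matrix.mul_assoc Q₀.1ᵀ, hQ, Matrix.one_mul,
    Matrix.mul_assoc, Matrix.mul_nonsing_inv _ hS, Matrix.mul_one]

theorem base_mem_symSectionDomain (Q₀ : stiefel n k) (S₀ : symPos k) :
    assocMatrix (assocMk (Q₀, S₀)) ∈ symSectionDomain Q₀ S₀ :=
  mem_symSectionDomain (A := assocToSym (assocMk (Q₀, S₀))) (by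
    change assocMatrix (assocMk (Q₀, S₀)) * _ ∈ _
    rw [assocMatrix_assocMk_mul]; exact mem_orthDomain Q₀)

theorem symSection_base (Q₀ : stiefel n k) (S₀ : symPos k) :
    symSection Q₀ S₀ (assocMatrix (assocMk (Q₀, S₀))) = (Q₀, S₀) := by
  have hQ : Q₀.1ᵀ * Q₀.1 = 1 := Q₀.2
  have h1 : symFrame Q₀ S₀ (assocMatrix (assocMk (Q₀, S₀))) = Q₀ := by
    rw [symFrame, assocMatrix_assocMk_mul, orthStiefel_coe]
  rw [symSection, h1]
  have h2 : Q₀.1ᵀ * assocMatrix (assocMk (Q₀, S₀)) * Q₀.1 = S₀.1.1 := by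
    rw [assocMatrix_mk]
    calc _ = Q₀.1ᵀ * Q₀.1 * S₀.1.1 * (Q₀.1ᵀ * Q₀.1) := by simp only [Matrix.mul_assoc]
      _ = _ := by simp [hQ]
  rw [h2, toSymPos_coe]

theorem contDiffAt_coe_symFrame {Q₀ : stiefel n k} {S₀ : symPos k}
    {Y : Matrix (Fin n) (Fin n) ℝ} (hY : Y * (Q₀.1 * S₀.1.1⁻¹) ∈ orthDomain n k) :
    ContDiffAt ℝ ∞ (fun Y => (symFrame Q₀ S₀ Y).1) Y := by
  have h1 : ContDiff ℝ ∞ fun Y : Matrix (Fin n) (Fin n) ℝ => Y * (Q₀.1 * S₀.1.1⁻¹) :=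
    contDiff_matrix_mul.comp (contDiff_id.prodMk contDiff_const)
  exact ContDiffAt.comp (g := fun X => (orthStiefel Q₀ X).1) Y
    (contDiffAt_coe_orthStiefel Q₀ hY) h1.contDiffAt

theorem contDiffAt_symFrame_conj {Q₀ : stiefel n k} {S₀ : symPos k}
    {Y : Matrix (Fin n) (Fin n) ℝ} (hY : Y * (Q₀.1 * S₀.1.1⁻¹) ∈ orthDomain n k) :
    ContDiffAt ℝ ∞ (fun Y => (symFrame Q₀ S₀ Y).1ᵀ * Y * (symFrame Q₀ S₀ Y).1) Y := by
  have h1 := contDiffAt_coe_symFrame hY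
  have h2 := contDiff_matrix_transpose.contDiffAt.comp Y h1
  exact contDiff_matrix_mul.contDiffAt.comp Y
    ((contDiff_matrix_mul.contDiffAt.comp Y (h2.prodMk contDiffAt_id)).prodMk h1)

theorem isOpen_symSectionDomain (Q₀ : stiefel n k) (S₀ : symPos k) :
    IsOpen (symSectionDomain Q₀ S₀) := by
  have h1 : Continuous fun Y : Matrix (Fin n) (Fin n) ℝ => Y * (Q₀.1 * S₀.1.1⁻¹) := by fun_prop
  have h2 : IsOpen {Y : Matrix (Fin n) (Fin n) ℝ | Y * (Q₀.1 * S₀.1.1⁻¹) ∈ orthDomain n k} :=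
    (orth_spec n k).1.preimage h1
  have h3 : ContinuousOn (fun Y => (symFrame Q₀ S₀ Y).1ᵀ * Y * (symFrame Q₀ S₀ Y).1)
      {Y : Matrix (Fin n) (Fin n) ℝ | Y * (Q₀.1 * S₀.1.1⁻¹) ∈ orthDomain n k} :=
    fun Y hY => (contDiffAt_symFrame_conj hY).continuousAt.continuousWithinAt
  exact h3.isOpen_inter_preimage h2 isOpen_posDef_symPart

theorem continuousAt_symSection {Q₀ : stiefel n k} {S₀ : symPos k}
    {Y : Matrix (Fin n) (Fin n) ℝ} (hY : Y ∈ symSectionDomain Q₀ S₀) :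
    ContinuousAt (symSection Q₀ S₀) Y := by
  refine ContinuousAt.prodMk ?_ ?_
  · exact IsEmbedding.subtypeVal.isInducing.continuousAt_iff.2
      (contDiffAt_coe_symFrame hY.1).continuousAt
  · exact ContinuousAt.comp (g := toSymPos) (contMDiffAt_toSymPos hY.2).continuousAt
      (contDiffAt_symFrame_conj hY.1).continuousAt

/-- A continuous injection out of a quotient is an embedding as soon as the quotient map has
continuous local sections in terms of the values of the injection. -/
theorem Topology.IsEmbedding.of_local_section {X Y V : Type*} [TopologicalSpace X]
    [TopologicalSpace Y] [TopologicalSpace V] {q : Y → X} (hq : Continuous q) {ι : X → V}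
    (hι : Continuous ι) (hinj : Function.Injective ι)
    (h : ∀ x₀, ∃ s : V → Y, ContinuousAt s (ι x₀) ∧
      ∀ᶠ v in 𝓝 (ι x₀), ∀ x, ι x = v → q (s v) = x) : IsEmbedding ι := by
  refine ⟨isInducing_iff_nhds.2 fun x₀ => le_antisymm (hι.tendsto x₀).le_comap ?_, hinj⟩
  obtain ⟨s, hs, hsx⟩ := h x₀
  have h1 : Filter.Tendsto (q ∘ s ∘ ι) (Filter.comap ι (𝓝 (ι x₀))) (𝓝 x₀) := by
    have h2 : Filter.Tendsto (q ∘ s) (𝓝 (ι x₀)) (𝓝 x₀) := by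
      have := hq.continuousAt.comp hs
      rwa [ContinuousAt, Function.comp_apply, hsx.self_of_nhds x₀ rfl] at this
    exact h2.comp Filter.tendsto_comap
  have h2 : q ∘ s ∘ ι =ᶠ[Filter.comap ι (𝓝 (ι x₀))] id := by
    filter_upwards [Filter.tendsto_comap.eventually hsx] with x hx using hx x rfl
  exact Filter.tendsto_id'.1 (h1.congr' h2)

theorem continuous_grProj : Continuous (grProj (n := n) (k := k)) := continuous_coinduced_rng

theorem continuous_assocMk : Continuous (assocMk (n := n) (k := k)) := continuous_quot_mk

theorem continuous_grMatrix : Continuous (grMatrix (n := n) (k := k)) := by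
  rw [continuous_coinduced_dom]
  have : grMatrix ∘ grProj = fun Q : stiefel n k => Q.1 * Q.1ᵀ := funext grMatrix_grProj
  rw [this]
  fun_prop

theorem continuous_assocMatrix : Continuous (assocMatrix (n := n) (k := k)) := by
  refine Continuous.quotient_lift ?_ _
  have h1 : Continuous fun p : stiefel n k × symPos k => p.2.1.1 :=
    continuous_subtype_val.comp (continuous_subtype_val.comp continuous_snd)
  fun_prop

/-- The frame of a subspace near the span of `Q₀`: an orthonormalization of the projection of
`Q₀`. -/
noncomputable def grFrame (Q₀ : stiefel n k) (Y : Matrix (Fin n) (Fin n) ℝ) : stiefel n k :=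
  orthStiefel Q₀ (Y * Q₀.1)

theorem grProj_grFrame (Q₀ : stiefel n k) {P : Gr k n}
    (hP : grMatrix P * Q₀.1 ∈ orthDomain n k) : grProj (grFrame Q₀ (grMatrix P)) = P :=
  grProj_orthStiefel Q₀ hP
    ((Matrix.range_mulVecLin_mul_le _ _).trans (range_grMatrix P).le)

theorem grMatrix_grProj_mul (Q₀ : stiefel n k) : grMatrix (grProj Q₀) * Q₀.1 = Q₀.1 := by
  have hQ : Q₀.1ᵀ * Q₀.1 = 1 := Q₀.2
  rw [grMatrix_grProj, Matrix.mul_assoc, hQ, Matrix.mul_one]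

theorem grMatrix_grProj_mul_mem_orthDomain (Q₀ : stiefel n k) :
    grMatrix (grProj Q₀) * Q₀.1 ∈ orthDomain n k := by
  rw [grMatrix_grProj_mul]
  exact mem_orthDomain Q₀

theorem grFrame_grMatrix_grProj (Q₀ : stiefel n k) :
    grFrame Q₀ (grMatrix (grProj Q₀)) = Q₀ := by
  rw [grFrame, grMatrix_grProj_mul, orthStiefel_coe]

theorem contDiffAt_coe_grFrame {Q₀ : stiefel n k} {Y : Matrix (Fin n) (Fin n) ℝ}
    (hY : Y * Q₀.1 ∈ orthDomain n k) : ContDiffAt ℝ ∞ (fun Y => (grFrame Q₀ Y).1) Y := by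
  have h1 : ContDiff ℝ ∞ fun Y : Matrix (Fin n) (Fin n) ℝ => Y * Q₀.1 :=
    contDiff_matrix_mul.comp (contDiff_id.prodMk contDiff_const)
  exact ContDiffAt.comp (g := fun X => (orthStiefel Q₀ X).1) Y
    (contDiffAt_coe_orthStiefel Q₀ hY) h1.contDiffAt

theorem isOpen_grFrameDomain (Q₀ : stiefel n k) :
    IsOpen {Y : Matrix (Fin n) (Fin n) ℝ | Y * Q₀.1 ∈ orthDomain n k} :=
  (orth_spec n k).1.preimage (by fun_prop)

theorem isEmbedding_grMatrix : IsEmbedding (grMatrix (n := n) (k := k)) := by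
  refine .of_local_section continuous_grProj continuous_grMatrix grMatrix_injective fun P => ?_
  obtain ⟨Q₀, rfl⟩ := grProj_surjective P
  have h0 := grMatrix_grProj_mul_mem_orthDomain Q₀
  refine ⟨grFrame Q₀, IsEmbedding.subtypeVal.isInducing.continuousAt_iff.2
    (contDiffAt_coe_grFrame h0).continuousAt, ?_⟩
  filter_upwards [(isOpen_grFrameDomain Q₀).mem_nhds h0]
  rintro _ hY P rfl
  exact grProj_grFrame Q₀ hY

theorem isEmbedding_assocMatrix : IsEmbedding (assocMatrix (n := n) (k := k)) := by
  refine .of_local_section continuous_assocMk continuous_assocMatrix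
    (fun x y h => assocToSym_injective (Subtype.ext h)) fun x => ?_
  obtain ⟨⟨Q₀, S₀⟩, rfl⟩ := assocMk_surjective x
  refine ⟨symSection Q₀ S₀, continuousAt_symSection (base_mem_symSectionDomain Q₀ S₀), ?_⟩
  filter_upwards [(isOpen_symSectionDomain Q₀ S₀).mem_nhds (base_mem_symSectionDomain Q₀ S₀)]
  rintro _ hY x rfl
  exact assocToSym_injective (assocToSym_symSection (A := assocToSym x) hY)

end LocalSections

/-! ### Smoothness with respect to an embedded Stiefel manifold -/

section SmoothMaps

variable {l m n k : ℕ} {E H Z : Type*} [NormedAddCommGroup E] [NormedSpace ℝ E]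
  [TopologicalSpace H] {I : ModelWithCorners ℝ E H} [TopologicalSpace Z] [ChartedSpace H Z]

theorem ContMDiffAt.matrix_mul {f : Z → Matrix (Fin l) (Fin m) ℝ}
    {g : Z → Matrix (Fin m) (Fin n) ℝ} {z : Z}
    (hf : ContMDiffAt I 𝓘(ℝ, Matrix (Fin l) (Fin m) ℝ) ∞ f z)
    (hg : ContMDiffAt I 𝓘(ℝ, Matrix (Fin m) (Fin n) ℝ) ∞ g z) :
    ContMDiffAt I 𝓘(ℝ, Matrix (Fin l) (Fin n) ℝ) ∞ (fun x => f x * g x) z :=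
  contDiff_matrix_mul.contMDiff.contMDiffAt.comp z (hf.prodMk_space hg)

theorem ContMDiffAt.matrix_transpose {f : Z → Matrix (Fin l) (Fin m) ℝ} {z : Z}
    (hf : ContMDiffAt I 𝓘(ℝ, Matrix (Fin l) (Fin m) ℝ) ∞ f z) :
    ContMDiffAt I 𝓘(ℝ, Matrix (Fin m) (Fin l) ℝ) ∞ (fun x => (f x)ᵀ) z :=
  contDiff_matrix_transpose.contMDiff.contMDiffAt.comp z hf

theorem contMDiff_coe_symPos : ContMDiff 𝓘(ℝ, symMatrix k) 𝓘(ℝ, Matrix (Fin k) (Fin k) ℝ) ∞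
    fun S : symPos k => S.1.1 :=
  (symMatrix k).subtypeL.contDiff.contMDiff.comp
    (IsSmoothEmbedding.of_opens (symPos k)).contMDiff

variable {d : ℕ} [ChartedSpace (EuclideanSpace ℝ (Fin d)) (stiefel n k)]

theorem contMDiff_grMatrix_comp_grProj
    (hSt : IsSmoothEmbedding (𝓡 d) 𝓘(ℝ, Matrix (Fin n) (Fin k) ℝ) ∞
      (Subtype.val : stiefel n k → Matrix (Fin n) (Fin k) ℝ)) :
    ContMDiff (𝓡 d) 𝓘(ℝ, Matrix (Fin n) (Fin n) ℝ) ∞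
      (grMatrix ∘ grProj (n := n) (k := k)) := by
  have : grMatrix ∘ grProj = fun Q : stiefel n k => Q.1 * Q.1ᵀ := funext grMatrix_grProj
  rw [this]
  exact fun Q => (hSt.contMDiff Q).matrix_mul (hSt.contMDiff Q).matrix_transpose

theorem contMDiff_assocMatrix_comp_assocMk
    (hSt : IsSmoothEmbedding (𝓡 d) 𝓘(ℝ, Matrix (Fin n) (Fin k) ℝ) ∞
      (Subtype.val : stiefel n k → Matrix (Fin n) (Fin k) ℝ)) :
    ContMDiff ((𝓡 d).prod 𝓘(ℝ, symMatrix k)) 𝓘(ℝ, Matrix (Fin n) (Fin n) ℝ) ∞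
      (assocMatrix ∘ assocMk (n := n) (k := k)) := by
  intro p
  have h1 := (hSt.contMDiff.comp (contMDiff_fst (I := 𝓡 d) (J := 𝓘(ℝ, symMatrix k))
    (M := stiefel n k) (N := symPos k))) p
  have h2 := ((contMDiff_coe_symPos (k := k)).comp (contMDiff_snd (I := 𝓡 d)
    (J := 𝓘(ℝ, symMatrix k)) (M := stiefel n k) (N := symPos k))) p
  exact (h1.matrix_mul h2).matrix_mul h1.matrix_transpose

theorem contMDiffAt_grFrame
    (hSt : IsSmoothEmbedding (𝓡 d) 𝓘(ℝ, Matrix (Fin n) (Fin k) ℝ) ∞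
      (Subtype.val : stiefel n k → Matrix (Fin n) (Fin k) ℝ))
    {Q₀ : stiefel n k} {Y : Matrix (Fin n) (Fin n) ℝ} (hY : Y * Q₀.1 ∈ orthDomain n k) :
    ContMDiffAt 𝓘(ℝ, Matrix (Fin n) (Fin n) ℝ) (𝓡 d) ∞ (grFrame Q₀) Y :=
  hSt.contMDiffAt_of_comp (contDiffAt_coe_grFrame hY).contMDiffAt

theorem contMDiffAt_symFrame
    (hSt : IsSmoothEmbedding (𝓡 d) 𝓘(ℝ, Matrix (Fin n) (Fin k) ℝ) ∞
      (Subtype.val : stiefel n k → Matrix (Fin n) (Fin k) ℝ))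
    {Q₀ : stiefel n k} {S₀ : symPos k} {Y : Matrix (Fin n) (Fin n) ℝ}
    (hY : Y ∈ symSectionDomain Q₀ S₀) :
    ContMDiffAt 𝓘(ℝ, Matrix (Fin n) (Fin n) ℝ) (𝓡 d) ∞ (symFrame Q₀ S₀) Y :=
  hSt.contMDiffAt_of_comp (contDiffAt_coe_symFrame hY.1).contMDiffAt

theorem contMDiffAt_symSection
    (hSt : IsSmoothEmbedding (𝓡 d) 𝓘(ℝ, Matrix (Fin n) (Fin k) ℝ) ∞
      (Subtype.val : stiefel n k → Matrix (Fin n) (Fin k) ℝ))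
    {Q₀ : stiefel n k} {S₀ : symPos k} {Y : Matrix (Fin n) (Fin n) ℝ}
    (hY : Y ∈ symSectionDomain Q₀ S₀) :
    ContMDiffAt 𝓘(ℝ, Matrix (Fin n) (Fin n) ℝ) ((𝓡 d).prod 𝓘(ℝ, symMatrix k)) ∞
      (symSection Q₀ S₀) Y :=
  (contMDiffAt_symFrame hSt hY).prodMk ((contMDiffAt_toSymPos hY.2).comp Y
    (contDiffAt_symFrame_conj hY.1).contMDiffAt)

end SmoothMaps

/-! ### Existence of the standard smooth structures -/

section Existence

variable {m n k : ℕ}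

theorem isSmoothRetractionOn_orth (n k : ℕ) :
    IsSmoothRetractionOn (orth n k) (orthDomain n k)
      (range (Subtype.val : stiefel n k → Matrix (Fin n) (Fin k) ℝ)) := by
  obtain ⟨h1, -, h3, h4, h5⟩ := orth_spec n k
  refine ⟨h1, h3, fun X hX => ?_, fun X hX => ?_⟩
  · simpa using (h5 X hX).1
  · exact h4 X (by simpa using hX.1)

/-- The space of orthogonal projections of rank `k`, with which `Gr(k,n)` is identified, is locally
a smooth retract of the space of matrices. -/
theorem isSmoothRetractionOn_gr (Q₀ : stiefel n k) :
    IsSmoothRetractionOn (fun Y => (grFrame Q₀ Y).1 * (grFrame Q₀ Y).1ᵀ)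
      {Y : Matrix (Fin n) (Fin n) ℝ | Y * Q₀.1 ∈ orthDomain n k}
      (range (grMatrix (n := n) (k := k))) := by
  refine ⟨isOpen_grFrameDomain Q₀, fun Y hY => ?_, fun Y _ => ?_, ?_⟩
  · have h := contDiffAt_coe_grFrame hY
    exact (contDiff_matrix_mul.contDiffAt.comp Y
      (h.prodMk (contDiff_matrix_transpose.contDiffAt.comp Y h))).contDiffWithinAt
  · exact ⟨grProj (grFrame Q₀ Y), grMatrix_grProj _⟩
  · rintro _ ⟨⟨P, rfl⟩, hP⟩
    rw [← grMatrix_grProj, grProj_grFrame Q₀ hP]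

theorem range_assocMatrix : range (assocMatrix (n := n) (k := k)) = symRank n k := by
  ext A
  constructor
  · rintro ⟨x, rfl⟩
    exact (assocToSym x).2
  · intro hA
    obtain ⟨x, hx⟩ := assocToSym_surjective ⟨A, hA⟩
    exact ⟨x, congrArg Subtype.val hx⟩

/-- `Sym(n,k)` is locally a smooth retract of the space of matrices. -/
theorem isSmoothRetractionOn_symRank (Q₀ : stiefel n k) (S₀ : symPos k) :
    IsSmoothRetractionOn (fun Y => assocMatrix (assocMk (symSection Q₀ S₀ Y)))
      (symSectionDomain Q₀ S₀) (symRank n k) := by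
  refine ⟨isOpen_symSectionDomain Q₀ S₀, fun Y hY => ?_, fun Y _ => ?_, ?_⟩
  · have h1 := contDiffAt_coe_symFrame hY.1
    have h2 := ((symMatrix k).subtypeL.contDiff (n := ∞)).contDiffAt.comp Y
      ((contDiffAt_coe_toSymPos hY.2).comp Y (contDiffAt_symFrame_conj hY.1))
    exact (contDiff_matrix_mul.contDiffAt.comp Y
      ((contDiff_matrix_mul.contDiffAt.comp Y (h1.prodMk h2)).prodMk
        (contDiff_matrix_transpose.contDiffAt.comp Y h1))).contDiffWithinAt
  · rw [← range_assocMatrix]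
    exact mem_range_self _
  · rintro A ⟨hA, hAW⟩
    exact congrArg Subtype.val (assocToSym_symSection (A := ⟨A, hA⟩) hAW)

/-- Left multiplication by an invertible matrix. -/
noncomputable def mulLeftEquiv (g h : Matrix (Fin n) (Fin n) ℝ) (hgh : g * h = 1) (hhg : h * g = 1)
    (m : ℕ) : Matrix (Fin n) (Fin m) ℝ ≃L[ℝ] Matrix (Fin n) (Fin m) ℝ :=
  ContinuousLinearEquiv.equivOfInverse (matrixMulCLM n n m g) (matrixMulCLM n n m h)
    (fun X => by simp [matrixMulCLM_apply, ← Matrix.mul_assoc, hhg])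
    (fun X => by simp [matrixMulCLM_apply, ← Matrix.mul_assoc, hgh])

/-- Congruence `Y ↦ g Y gᵀ` by an invertible matrix. -/
noncomputable def congrEquiv (g h : Matrix (Fin n) (Fin n) ℝ) (hgh : g * h = 1) (hhg : h * g = 1) :
    Matrix (Fin n) (Fin n) ℝ ≃L[ℝ] Matrix (Fin n) (Fin n) ℝ :=
  (mulLeftEquiv g h hgh hhg n).trans
    (ContinuousLinearEquiv.equivOfInverse ((matrixMulCLM n n n).flip gᵀ)
      ((matrixMulCLM n n n).flip hᵀ)
      (fun X => by
        simp [matrixMulCLM_apply, Matrix.mul_assoc, ← Matrix.transpose_mul, hhg])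
      (fun X => by
        simp [matrixMulCLM_apply, Matrix.mul_assoc, ← Matrix.transpose_mul, hgh]))

theorem congrEquiv_apply {g h : Matrix (Fin n) (Fin n) ℝ} (hgh : g * h = 1) (hhg : h * g = 1)
    (Y : Matrix (Fin n) (Fin n) ℝ) : congrEquiv g h hgh hhg Y = g * Y * gᵀ := rfl

theorem congrEquiv_symm_apply {g h : Matrix (Fin n) (Fin n) ℝ} (hgh : g * h = 1)
    (hhg : h * g = 1) (Y : Matrix (Fin n) (Fin n) ℝ) :
    (congrEquiv g h hgh hhg).symm Y = h * (Y * hᵀ) := rfl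

theorem ContinuousLinearEquiv.image_eq_of_mapsTo {V : Type*} [NormedAddCommGroup V]
    [NormedSpace ℝ V] (L : V ≃L[ℝ] V) {S : Set V} (h : MapsTo L S S) (h' : MapsTo L.symm S S) :
    L '' S = S := by
  refine Subset.antisymm h.image_subset fun y hy => ?_
  exact ⟨L.symm y, h' hy, L.apply_symm_apply y⟩

theorem mul_mem_stiefel {U : Matrix (Fin n) (Fin n) ℝ} (hU : Uᵀ * U = 1)
    {Q : Matrix (Fin n) (Fin k) ℝ} (hQ : Q ∈ stiefel n k) : U * Q ∈ stiefel n k := by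
  have hQ : Qᵀ * Q = 1 := hQ
  change (U * Q)ᵀ * (U * Q) = 1
  rw [Matrix.transpose_mul, Matrix.mul_assoc, ← Matrix.mul_assoc Uᵀ, hU, Matrix.one_mul, hQ]

/-- Congruence by an invertible matrix preserves `Sym(n,k)`. -/
theorem congr_mem_symRank {g : Matrix (Fin n) (Fin n) ℝ} (hg : IsUnit g)
    {A : Matrix (Fin n) (Fin n) ℝ} (hA : A ∈ symRank n k) : g * A * gᵀ ∈ symRank n k := by
  have hd := (Matrix.isUnit_iff_isUnit_det _).1 hg
  refine ⟨?_, ?_⟩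
  · have := hA.1.mul_mul_conjTranspose_same g
    rwa [Matrix.conjTranspose_eq_transpose_of_trivial] at this
  · rw [Matrix.rank_mul_eq_left_of_isUnit_det _ _ (by rwa [Matrix.det_transpose]),
      Matrix.rank_mul_eq_right_of_isUnit_det _ _ hd]
    exact hA.2

theorem nonempty_stiefel (hk : k ≤ n) : Nonempty (stiefel n k) := by
  refine ⟨⟨(1 : Matrix (Fin n) (Fin n) ℝ).submatrix id (Fin.castLE hk), ?_⟩⟩
  change _ᵀ * _ = (1 : Matrix (Fin k) (Fin k) ℝ)
  rw [Matrix.transpose_submatrix, Matrix.transpose_one,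
    ← Matrix.submatrix_mul _ _ _ _ _ Function.bijective_id, Matrix.mul_one]
  exact Matrix.submatrix_one _ (Fin.castLE_injective hk)

/-- `GL(n)` carries a given orthonormal frame `Q` to any frame `Q' R`: an orthogonal matrix that
maps `Q` to `Q'` is composed with the map acting as `R` on the span of `Q` and as the identity on
its complement. -/
theorem exists_isUnit_mul_eq {Q Q' : Matrix (Fin n) (Fin k) ℝ} (hQ : Q ∈ stiefel n k)
    (hQ' : Q' ∈ stiefel n k) {R : Matrix (Fin k) (Fin k) ℝ} (hR : IsUnit R) :
    ∃ g h : Matrix (Fin n) (Fin n) ℝ, g * h = 1 ∧ h * g = 1 ∧ g * Q = Q' * R := by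
  obtain ⟨U, hU1, hU2, hUQ⟩ := exists_orthogonal_mul_eq hQ hQ'
  have hd := (Matrix.isUnit_iff_isUnit_det _).1 hR
  have hQ1 : Qᵀ * Q = 1 := hQ
  have key : (Q * R * Qᵀ + (1 - Q * Qᵀ)) * (Q * R⁻¹ * Qᵀ + (1 - Q * Qᵀ)) = 1 := by
    have h1 : Qᵀ * (1 - Q * Qᵀ) = 0 := by
      rw [Matrix.mul_sub, ← Matrix.mul_assoc, hQ1]; simp
    have h2 : (1 - Q * Qᵀ) * Q = 0 := by
      rw [Matrix.sub_mul, Matrix.mul_assoc, hQ1]; simp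
    calc _ = Q * (R * (Qᵀ * Q) * R⁻¹) * Qᵀ + Q * R * (Qᵀ * (1 - Q * Qᵀ))
          + (1 - Q * Qᵀ) * Q * R⁻¹ * Qᵀ + (1 - Q * Qᵀ - Q * (Qᵀ * (1 - Q * Qᵀ))) := by
          simp only [Matrix.mul_assoc, Matrix.add_mul, Matrix.mul_add, Matrix.sub_mul,
            Matrix.mul_sub, Matrix.one_mul, Matrix.mul_one]
          abel
      _ = 1 := by
        rw [h1, h2, hQ1, Matrix.mul_one, Matrix.mul_nonsing_inv _ hd]
        simp
  set a := Q * R * Qᵀ + (1 - Q * Qᵀ) with ha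
  set b := Q * R⁻¹ * Qᵀ + (1 - Q * Qᵀ) with hb
  have key' : b * a = 1 := mul_eq_one_comm.1 key
  refine ⟨U * a, b * Uᵀ, ?_, ?_, ?_⟩
  · rw [Matrix.mul_assoc, ← Matrix.mul_assoc a, key, Matrix.one_mul, hU2]
  · rw [Matrix.mul_assoc, ← Matrix.mul_assoc Uᵀ, hU1, Matrix.one_mul, key']
  · have h3 : a * Q = Q * R := by
      rw [ha, Matrix.add_mul, Matrix.sub_mul, Matrix.mul_assoc, hQ1, Matrix.mul_assoc Q Qᵀ, hQ1]
      simp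
    rw [Matrix.mul_assoc, h3, ← Matrix.mul_assoc, hUQ]

theorem exists_isEmbeddedSubmanifold_stiefel (hk : k ≤ n) :
    ∃ (d : ℕ) (_ : ChartedSpace (EuclideanSpace ℝ (Fin d)) (stiefel n k)),
      IsEmbeddedSubmanifold d 𝓘(ℝ, Matrix (Fin n) (Fin k) ℝ) (stiefel n k) := by
  obtain ⟨Q₀⟩ := nonempty_stiefel hk
  obtain ⟨d, cs, h1, h2⟩ := IsEmbedding.subtypeVal.exists_isSmoothEmbedding_of_homogeneous Q₀
    (isSmoothRetractionOn_orth n k) (mem_orthDomain Q₀) (fun Q => by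
      obtain ⟨U, hU1, hU2, hUQ⟩ := exists_orthogonal_mul_eq Q₀.2 Q.2
      refine ⟨mulLeftEquiv U Uᵀ hU2 hU1 k, ?_, hUQ⟩
      rw [Subtype.range_coe]
      exact ContinuousLinearEquiv.image_eq_of_mapsTo _ (fun X hX => mul_mem_stiefel hU1 hX)
        (fun X hX => mul_mem_stiefel (by rwa [Matrix.transpose_transpose]) hX))
  exact ⟨d, cs, h1, h2⟩

/-- `Gr(k,n)` with the smooth structure of the manifold of orthogonal projections of rank `k`, which
is homogeneous under conjugation by `O(n)`. -/
theorem exists_smoothEmbedding_gr (hk : k ≤ n) :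
    ∃ (d : ℕ) (_ : ChartedSpace (EuclideanSpace ℝ (Fin d)) (Gr k n)), IsSmoothManifold d (Gr k n) ∧
      IsSmoothEmbedding (𝓡 d) 𝓘(ℝ, Matrix (Fin n) (Fin n) ℝ) ∞ (grMatrix (n := n) (k := k)) := by
  obtain ⟨Q₀⟩ := nonempty_stiefel hk
  refine isEmbedding_grMatrix.exists_isSmoothEmbedding_of_homogeneous (grProj Q₀)
    (isSmoothRetractionOn_gr Q₀) ?_ fun P => ?_
  · exact grMatrix_grProj_mul_mem_orthDomain Q₀
  · obtain ⟨Q, rfl⟩ := grProj_surjective P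
    obtain ⟨U, hU1, hU2, hUQ⟩ := exists_orthogonal_mul_eq Q₀.2 Q.2
    refine ⟨congrEquiv U Uᵀ hU2 hU1, ?_, ?_⟩
    · rw [range_grMatrix_eq]
      refine ContinuousLinearEquiv.image_eq_of_mapsTo _ ?_ ?_
      · rintro _ ⟨Q', hQ', rfl⟩
        exact ⟨U * Q', mul_mem_stiefel hU1 hQ', by
          simp only [congrEquiv_apply, Matrix.transpose_mul, Matrix.mul_assoc]⟩
      · rintro _ ⟨Q', hQ', rfl⟩
        exact ⟨Uᵀ * Q', mul_mem_stiefel (by rwa [Matrix.transpose_transpose]) hQ', by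
          simp only [congrEquiv_symm_apply, Matrix.transpose_mul, Matrix.mul_assoc]⟩
    · rw [grMatrix_grProj, grMatrix_grProj, congrEquiv_apply, ← hUQ]
      simp only [Matrix.transpose_mul, Matrix.mul_assoc]

/-- The smooth structure on any space that is embedded with image `Sym(n,k)`, which is homogeneous
under congruence by `GL(n)`. It serves both for `Sym(n,k)` itself and for `M(n,k)`. -/
theorem exists_smoothEmbedding_of_range_eq_symRank (hk : k ≤ n) {X : Type*} [TopologicalSpace X]
    {ι : X → Matrix (Fin n) (Fin n) ℝ} (hι : IsEmbedding ι) (hr : range ι = symRank n k) :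
    ∃ (d : ℕ) (_ : ChartedSpace (EuclideanSpace ℝ (Fin d)) X), IsSmoothManifold d X ∧
      IsSmoothEmbedding (𝓡 d) 𝓘(ℝ, Matrix (Fin n) (Fin n) ℝ) ∞ ι := by
  obtain ⟨Q₀⟩ := nonempty_stiefel hk
  -- the base point is the orthogonal projection `Q₀ Q₀ᵀ`
  let S₀ : symPos k := ⟨⟨1, Matrix.transpose_one⟩, Matrix.PosDef.one⟩
  obtain ⟨x₀, hx₀⟩ : assocMatrix (assocMk (Q₀, S₀)) ∈ range ι := by
    rw [hr]; exact (assocToSym (assocMk (Q₀, S₀))).2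
  refine hι.exists_isSmoothEmbedding_of_homogeneous x₀
    (by rw [hr]; exact isSmoothRetractionOn_symRank Q₀ S₀) ?_ fun x => ?_
  · rw [hx₀]
    exact base_mem_symSectionDomain Q₀ S₀
  · have hx : ι x ∈ symRank n k := hr ▸ mem_range_self x
    obtain ⟨y, hy⟩ := assocToSym_surjective ⟨ι x, hx⟩
    obtain ⟨⟨Q, S⟩, rfl⟩ := assocMk_surjective y
    have hy : Q.1 * S.1.1 * Q.1ᵀ = ι x := congrArg Subtype.val hy
    obtain ⟨C, hC, hSC⟩ := (symPos_posDef S).exists_eq_transpose_mul_self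
    obtain ⟨g, h, hgh, hhg, hgQ⟩ := exists_isUnit_mul_eq Q₀.2 Q.2
      ((Matrix.isUnit_transpose _).2 hC)
    have hg : IsUnit g := ⟨⟨g, h, hgh, hhg⟩, rfl⟩
    have hh : IsUnit h := ⟨⟨h, g, hhg, hgh⟩, rfl⟩
    refine ⟨congrEquiv g h hgh hhg, ?_, ?_⟩
    · rw [hr]
      refine ContinuousLinearEquiv.image_eq_of_mapsTo _ (fun A hA => congr_mem_symRank hg hA)
        fun A hA => ?_
      rw [congrEquiv_symm_apply, ← Matrix.mul_assoc]
      exact congr_mem_symRank hh hA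
    · rw [hx₀, assocMatrix_mk, congrEquiv_apply, ← hy, hSC]
      calc g * (Q₀.1 * (1 : Matrix (Fin k) (Fin k) ℝ) * Q₀.1ᵀ) * gᵀ = (g * Q₀.1) * (g * Q₀.1)ᵀ := by
            simp only [Matrix.mul_one, Matrix.transpose_mul, Matrix.mul_assoc]
        _ = _ := by
            rw [hgQ]
            simp only [Matrix.transpose_mul, Matrix.transpose_transpose, Matrix.mul_assoc]

/-- The standard smooth structures exist: `St(n,k)`, `Gr(k,n)`, `M(n,k)` and `Sym(n,k)` are embedded
as homogeneous local retracts, and the local sections show that the quotient maps are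
submersions. -/
theorem exists_isStandard (hk : k ≤ n) : ∃ (dSt dGr dM dSym : ℕ)
      (_ : ChartedSpace (EuclideanSpace ℝ (Fin dSt)) (stiefel n k))
      (_ : ChartedSpace (EuclideanSpace ℝ (Fin dGr)) (Gr k n))
      (_ : ChartedSpace (EuclideanSpace ℝ (Fin dM)) (AssocBundle n k))
      (_ : ChartedSpace (EuclideanSpace ℝ (Fin dSym)) (symRank n k)),
      IsStandard n k dSt dGr dM dSym := by
  obtain ⟨dSt, cSt, hSt⟩ := exists_isEmbeddedSubmanifold_stiefel hk
  obtain ⟨dGr, cGr, hGrm, hGr⟩ := exists_smoothEmbedding_gr hk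
  obtain ⟨dM, cM, hMm, hM⟩ := exists_smoothEmbedding_of_range_eq_symRank hk
    (isEmbedding_assocMatrix (n := n) (k := k)) range_assocMatrix
  obtain ⟨dSym, cSym, hSymm, hSym⟩ := exists_smoothEmbedding_of_range_eq_symRank hk
    (IsEmbedding.subtypeVal (p := (· ∈ symRank n k))) Subtype.range_coe
  have i1 := hSt.manifold.isManifold
  have i2 := hGrm.isManifold
  have i3 := hMm.isManifold
  refine ⟨dSt, dGr, dM, dSym, cSt, cGr, cM, cSym, hSt, ⟨hSymm, hSym⟩, hGrm, ?_, hMm, ?_⟩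
  · have hs : ContMDiff (𝓡 dSt) (𝓡 dGr) ∞ (grProj (n := n) (k := k)) := fun Q =>
      hGr.contMDiffAt_of_comp (contMDiff_grMatrix_comp_grProj hSt.embedding Q)
    refine hs.isSubmersion_of_rightInverse fun Q₀ => ⟨grFrame Q₀ ∘ grMatrix, ?_, ?_, ?_⟩
    · have h0 := grMatrix_grProj_mul_mem_orthDomain Q₀
      exact ((contMDiffAt_grFrame hSt.embedding h0).comp _ (hGr.contMDiff _)).mdifferentiableAt
        (by simp)
    · exact grFrame_grMatrix_grProj Q₀
    · have h0 := grMatrix_grProj_mul_mem_orthDomain Q₀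
      filter_upwards [continuous_grMatrix.continuousAt.eventually
        ((isOpen_grFrameDomain Q₀).mem_nhds h0)] with P hP using grProj_grFrame Q₀ hP
  · have hs : ContMDiff ((𝓡 dSt).prod 𝓘(ℝ, symMatrix k)) (𝓡 dM) ∞
        (assocMk (n := n) (k := k)) := fun p =>
      hM.contMDiffAt_of_comp (contMDiff_assocMatrix_comp_assocMk hSt.embedding p)
    refine hs.isSubmersion_of_rightInverse ?_
    rintro ⟨Q₀, S₀⟩
    have h0 := base_mem_symSectionDomain Q₀ S₀
    refine ⟨symSection Q₀ S₀ ∘ assocMatrix, ?_, symSection_base Q₀ S₀, ?_⟩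
    · exact ((contMDiffAt_symSection hSt.embedding h0).comp _ (hM.contMDiff _)).mdifferentiableAt
        (by simp)
    · filter_upwards [continuous_assocMatrix.continuousAt.eventually
        ((isOpen_symSectionDomain Q₀ S₀).mem_nhds h0)] with x hx
      exact assocToSym_injective (assocToSym_symSection (A := assocToSym x) hx)

end Existence

/-! ### Smooth fiber bundles and their fibers -/

section Fibers

variable {V₁ H₁ V₂ H₂ V E B : Type*}
  [NormedAddCommGroup V₁] [NormedSpace ℝ V₁] [TopologicalSpace H₁]
  [NormedAddCommGroup V₂] [NormedSpace ℝ V₂] [TopologicalSpace H₂]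
  [NormedAddCommGroup V] [NormedSpace ℝ V]
  {IE : ModelWithCorners ℝ V₁ H₁} {IB : ModelWithCorners ℝ V₂ H₂}
  [TopologicalSpace E] [ChartedSpace H₁ E] [TopologicalSpace B] [ChartedSpace H₂ B]

/-- A smooth fiber bundle pulls back along a diffeomorphism of total spaces. -/
theorem IsSmoothFiberBundle.comp_diffeomorph {V₁' H₁' V₃ H₃ E' F : Type*}
    [NormedAddCommGroup V₁'] [NormedSpace ℝ V₁'] [TopologicalSpace H₁']
    {IE' : ModelWithCorners ℝ V₁' H₁'} [TopologicalSpace E'] [ChartedSpace H₁' E']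
    [NormedAddCommGroup V₃] [NormedSpace ℝ V₃] [TopologicalSpace H₃]
    {IF : ModelWithCorners ℝ V₃ H₃} [TopologicalSpace F] [ChartedSpace H₃ F]
    {π : E → B} (hπ : IsSmoothFiberBundle IE IB IF F π) (Φ : E' ≃ₘ^∞⟮IE', IE⟯ E)
    {π' : E' → B} (h : ∀ x, π (Φ x) = π' x) : IsSmoothFiberBundle IE' IB IF F π' := by
  obtain rfl : π ∘ Φ = π' := funext h
  refine ⟨hπ.smooth.comp Φ.contMDiff, hπ.surjective.comp Φ.surjective, fun b => ?_⟩
  obtain ⟨e, hb, he, he'⟩ := hπ.locallyTrivial b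
  refine ⟨e.compHomeomorph Φ.toHomeomorph, hb, ?_, ?_⟩
  · exact he.comp Φ.contMDiff.contMDiffOn fun x hx => hx
  · have h1 : (e.compHomeomorph Φ.toHomeomorph).target = e.target := by
      rw [Bundle.Trivialization.target_eq, Bundle.Trivialization.target_eq]; rfl
    rw [h1]
    exact Φ.symm.contMDiff.comp_contMDiffOn he'

variable {F : TopologicalSpace.Opens V} {π : E → B}

/-- The fiber over a point of the base set of a trivialization is homeomorphic to the model. -/
noncomputable def Bundle.Trivialization.fiberHomeomorph (e : Bundle.Trivialization F π) {b : B}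
    (hb : b ∈ e.baseSet) : {x | π x = b} ≃ₜ F := e.preimageSingletonHomeomorph hb

theorem Bundle.Trivialization.contMDiff_coe_fiberHomeomorph_symm
    (e : Bundle.Trivialization F π) {b : B} (hb : b ∈ e.baseSet)
    (he' : ContMDiffOn (IB.prod 𝓘(ℝ, V)) IE ∞ e.toOpenPartialHomeomorph.symm e.target) :
    ContMDiff 𝓘(ℝ, V) IE ∞ fun f => ((e.fiberHomeomorph hb).symm f : E) := by
  refine ContMDiffOn.comp_contMDiff (f := fun f => ((b, f) : B × F)) he'
    (contMDiff_const.prodMk contMDiff_id) fun f => ?_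
  rw [e.target_eq]
  exact ⟨hb, mem_univ _⟩

theorem Bundle.Trivialization.contMDiffAt_snd (e : Bundle.Trivialization F π) {x : E}
    (hx : π x ∈ e.baseSet) (he : ContMDiffOn IE (IB.prod 𝓘(ℝ, V)) ∞ e e.source) :
    ContMDiffAt IE 𝓘(ℝ, V) ∞ (fun y => (e y).2) x :=
  contMDiff_snd.contMDiffAt.comp x
    (he.contMDiffAt (e.open_source.mem_nhds (e.mem_source.2 hx)))

/-- The fibers of a smooth fiber bundle are embedded submanifolds diffeomorphic to the model fiber:
a trivialization supplies a global chart of the fiber, and a smooth local left inverse of its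
inclusion. For any other embedded structure on the fiber, the trivialization remains a
diffeomorphism by the universal property of embeddings. -/
theorem IsSmoothFiberBundle.isSubmanifoldDiffeomorphicTo [FiniteDimensional ℝ V₁]
    [FiniteDimensional ℝ V] [IE.Boundaryless] [IsManifold IE ∞ E] [T2Space E]
    [SecondCountableTopology E] [Nonempty F]
    (hπ : IsSmoothFiberBundle IE IB 𝓘(ℝ, V) F π) (b : B) :
    IsSubmanifoldDiffeomorphicTo IE {x | π x = b} 𝓘(ℝ, V) F := by
  obtain ⟨e, hb, he, he'⟩ := hπ.locallyTrivial b
  have hbS : ∀ x : {x | π x = b}, π x ∈ e.baseSet := fun x => by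
    have : π x = b := x.2
    rwa [this]
  have hinv := e.contMDiff_coe_fiberHomeomorph_symm hb he'
  set h := e.fiberHomeomorph hb with hh
  refine ⟨?_, ?_⟩
  -- the atlas consists of the trivialization alone, composed with linear coordinates `ε` of `V`
  · let d := Module.finrank ℝ V
    let ε : V ≃L[ℝ] EuclideanSpace ℝ (Fin d) := ContinuousLinearEquiv.ofFinrankEq (by simp [d])
    have hj : IsOpenEmbedding (fun x : {x | π x = b} => ε (h x : V)) :=
      ε.toHomeomorph.isOpenEmbedding.comp
        (F.isOpenEmbedding'.comp h.isOpenEmbedding)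
    have hne : Nonempty {x | π x = b} := ⟨h.symm (Classical.arbitrary F)⟩
    let cs : ChartedSpace (EuclideanSpace ℝ (Fin d)) {x | π x = b} := hj.singletonChartedSpace
    have hm : IsManifold (𝓡 d) ∞ {x | π x = b} := hj.isManifold_singleton
    have hjs : ContMDiff (𝓡 d) (𝓡 d) ∞ (fun x : {x | π x = b} => ε (h x : V)) :=
      contMDiff_isOpenEmbedding hj
    have hhs : ContMDiff (𝓡 d) 𝓘(ℝ, V) ∞ h := fun x =>
      (IsSmoothEmbedding.of_opens F).contMDiffAt_of_comp (by
        refine ((ε.symm.contDiff.contMDiff.comp hjs) x).congr_of_eventuallyEq ?_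
        exact Filter.Eventually.of_forall fun y => by simp)
    have hhi : ContMDiff 𝓘(ℝ, V) (𝓡 d) ∞ h.symm := by
      refine ContMDiff.of_comp_isOpenEmbedding hj ?_
      refine (ε.contDiff.contMDiff.comp (IsSmoothEmbedding.of_opens F).contMDiff).congr ?_
      intro f
      simp
    have hval : ContMDiff (𝓡 d) IE ∞ (Subtype.val : {x | π x = b} → E) :=
      (hinv.comp hhs).congr fun x => by
        change x.1 = (h.symm (h x)).1
        rw [h.symm_apply_apply]
    refine ⟨d, cs, ⟨⟨inferInstance, inferInstance, hm⟩, ?_, .subtypeVal⟩⟩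
    refine hval.isImmersion_of_leftInverse fun x => ⟨h.symm ∘ fun y => (e y).2, ?_, ?_⟩
    · exact (hhi.contMDiffAt.comp x.1 (e.contMDiffAt_snd (hbS x) he)).mdifferentiableAt (by simp)
    · exact Filter.Eventually.of_forall fun y => h.symm_apply_apply y
  · intro d cs hS
    have := hS.manifold.isManifold
    refine ⟨⟨h.toEquiv, fun x => ?_, fun f => ?_⟩⟩
    · exact (e.contMDiffAt_snd (hbS x) he).comp x (hS.embedding.contMDiff x)
    · exact hS.embedding.contMDiffAt_of_comp (hinv f)

end Fibers

/-! ### The bundles over the Grassmannian -/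

section Bundles

theorem eventually_mem_symSectionDomain {n k : ℕ} (Q₀ : stiefel n k) (S₀ : symPos k) :
    ∀ᶠ A in 𝓝 (assocToSym (assocMk (Q₀, S₀))), A.1 ∈ symSectionDomain Q₀ S₀ :=
  continuous_subtype_val.continuousAt.eventually
    ((isOpen_symSectionDomain Q₀ S₀).mem_nhds (base_mem_symSectionDomain Q₀ S₀))

variable {n k dSt dGr dM dSym : ℕ}
  [ChartedSpace (EuclideanSpace ℝ (Fin dSt)) (stiefel n k)]
  [ChartedSpace (EuclideanSpace ℝ (Fin dGr)) (Gr k n)]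
  [ChartedSpace (EuclideanSpace ℝ (Fin dM)) (AssocBundle n k)]
  [ChartedSpace (EuclideanSpace ℝ (Fin dSym)) (symRank n k)]

namespace IsStandard

variable (h : IsStandard n k dSt dGr dM dSym)
include h

theorem contMDiff_grProj : ContMDiff (𝓡 dSt) (𝓡 dGr) ∞ (grProj (n := n) (k := k)) :=
  h.gr_submersion.contMDiff

theorem contMDiff_assocMk : ContMDiff ((𝓡 dSt).prod 𝓘(ℝ, symMatrix k)) (𝓡 dM) ∞
    (assocMk (n := n) (k := k)) := h.assoc_submersion.contMDiff

theorem contMDiff_grMatrix :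
    ContMDiff (𝓡 dGr) 𝓘(ℝ, Matrix (Fin n) (Fin n) ℝ) ∞ (grMatrix (n := n) (k := k)) :=
  h.gr_submersion.contMDiff_of_comp grProj_surjective
    (contMDiff_grMatrix_comp_grProj h.stiefel_submanifold.embedding)

theorem contMDiff_assocToSym :
    ContMDiff (𝓡 dM) (𝓡 dSym) ∞ (assocToSym (n := n) (k := k)) := by
  have h1 := h.assoc_submersion.contMDiff_of_comp assocMk_surjective
    (contMDiff_assocMatrix_comp_assocMk h.stiefel_submanifold.embedding)
  exact fun x => h.symRank_submanifold.embedding.contMDiffAt_of_comp (h1 x)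

/-- Near `Q₀ S₀ Q₀ᵀ` the inverse of `[Q, S] ↦ Q S Qᵀ` is `symSection` followed by the quotient
map. -/
theorem contMDiff_assocToSym_symm :
    ContMDiff (𝓡 dSym) (𝓡 dM) ∞
      (Equiv.ofBijective _
        ⟨assocToSym_injective (n := n) (k := k), assocToSym_surjective⟩).symm := by
  intro A
  obtain ⟨x, rfl⟩ := assocToSym_surjective A
  obtain ⟨⟨Q₀, S₀⟩, rfl⟩ := assocMk_surjective x
  have h1 := contMDiffAt_symSection h.stiefel_submanifold.embedding
    (base_mem_symSectionDomain Q₀ S₀)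
  have h2 := (h.contMDiff_assocMk.contMDiffAt.comp _ h1).comp (assocToSym (assocMk (Q₀, S₀)))
    (h.symRank_submanifold.embedding.contMDiff (assocToSym (assocMk (Q₀, S₀))))
  refine h2.congr_of_eventuallyEq ?_
  filter_upwards [eventually_mem_symSectionDomain Q₀ S₀] with A hA
  rw [Equiv.symm_apply_eq]
  exact (assocToSym_symSection hA).symm

/-- The diffeomorphism `[Q, S] ↦ Q S Qᵀ`. -/
noncomputable def assocDiffeomorph : AssocBundle n k ≃ₘ^∞⟮𝓡 dM, 𝓡 dSym⟯ symRank n k where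
  toEquiv := Equiv.ofBijective _ ⟨assocToSym_injective, assocToSym_surjective⟩
  contMDiff_toFun := h.contMDiff_assocToSym
  contMDiff_invFun := h.contMDiff_assocToSym_symm

/-- Near `Q₀ S₀ Q₀ᵀ` the projection to `Gr(k,n)` is `symFrame` followed by `grProj`. -/
theorem contMDiff_symProj : ContMDiff (𝓡 dSym) (𝓡 dGr) ∞ (symProj (n := n) (k := k)) := by
  intro A
  obtain ⟨x, rfl⟩ := assocToSym_surjective A
  obtain ⟨⟨Q₀, S₀⟩, rfl⟩ := assocMk_surjective x
  have h1 := contMDiffAt_symFrame h.stiefel_submanifold.embedding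
    (base_mem_symSectionDomain Q₀ S₀)
  have h2 := (h.contMDiff_grProj.contMDiffAt.comp _ h1).comp (assocToSym (assocMk (Q₀, S₀)))
    (h.symRank_submanifold.embedding.contMDiff (assocToSym (assocMk (Q₀, S₀))))
  refine h2.congr_of_eventuallyEq ?_
  filter_upwards [eventually_mem_symSectionDomain Q₀ S₀] with A hA
  exact symProj_eq_grProj_symFrame Q₀ S₀ hA.1

/-- A smooth frame `s` over an open set `U` of subspaces trivializes `Sym(n,k)` over `U` by
`A ↦ (Im A, s(Im A)ᵀ A s(Im A))`, with inverse `(P, S) ↦ s(P) S s(P)ᵀ`. -/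
theorem exists_trivialization_symProj (Q₀ : stiefel n k) :
    ∃ e : Bundle.Trivialization (symPos k) (symProj (n := n) (k := k)), grProj Q₀ ∈ e.baseSet ∧
      ContMDiffOn (𝓡 dSym) ((𝓡 dGr).prod 𝓘(ℝ, symMatrix k)) ∞ e e.source ∧
      ContMDiffOn ((𝓡 dGr).prod 𝓘(ℝ, symMatrix k)) (𝓡 dSym) ∞
        e.toOpenPartialHomeomorph.symm e.target := by
  let U : Set (Gr k n) := {P | grMatrix P * Q₀.1 ∈ orthDomain n k}
  have hU : IsOpen U := (isOpen_grFrameDomain Q₀).preimage continuous_grMatrix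
  let s : Gr k n → stiefel n k := fun P => grFrame Q₀ (grMatrix P)
  have hs : ∀ P ∈ U, grProj (s P) = P := fun P hP => grProj_grFrame Q₀ hP
  have hss : ∀ P ∈ U, ContMDiffAt (𝓡 dGr) (𝓡 dSt) ∞ s P := fun P hP =>
    (contMDiffAt_grFrame h.stiefel_submanifold.embedding hP).comp P (h.contMDiff_grMatrix P)
  have hsv : ∀ P ∈ U, ContMDiffAt (𝓡 dGr) 𝓘(ℝ, Matrix (Fin n) (Fin k) ℝ) ∞
      (fun P => (s P).1) P := fun P hP =>
    (h.stiefel_submanifold.embedding.contMDiff (s P)).comp P (hss P hP)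
  let C : symRank n k → Matrix (Fin k) (Fin k) ℝ := fun A =>
    (s (symProj A)).1ᵀ * A.1 * (s (symProj A)).1
  have hC : ∀ A, symProj A ∈ U → (C A).PosDef := fun A hA =>
    posDef_transpose_mul_mul_of_symProj_eq (hs _ hA).symm
  let f : symRank n k → Gr k n × symPos k := fun A => (symProj A, toSymPos (C A))
  let g : Gr k n × symPos k → symRank n k := fun p => assocToSym (assocMk (s p.1, p.2))
  have hsource : IsOpen (symProj ⁻¹' U : Set (symRank n k)) :=
    hU.preimage h.contMDiff_symProj.continuous
  have htarget : IsOpen (U ×ˢ (univ : Set (symPos k))) := hU.prod isOpen_univ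
  have hf : ContMDiffOn (𝓡 dSym) ((𝓡 dGr).prod 𝓘(ℝ, symMatrix k)) ∞ f (symProj ⁻¹' U) := by
    intro A hA
    have h1 := (hsv (symProj A) hA).comp A (h.contMDiff_symProj A)
    have h2 := h.symRank_submanifold.embedding.contMDiff A
    have h3 := (h1.matrix_transpose.matrix_mul h2).matrix_mul h1
    have h4 : ContMDiffAt 𝓘(ℝ, Matrix (Fin k) (Fin k) ℝ) 𝓘(ℝ, symMatrix k) ∞ toSymPos (C A) :=
      contMDiffAt_toSymPos (by rw [symPart_eq (hC A hA)]; exact hC A hA)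
    exact ((h.contMDiff_symProj A).prodMk (h4.comp A h3)).contMDiffWithinAt
  have hg : ContMDiffOn ((𝓡 dGr).prod 𝓘(ℝ, symMatrix k)) (𝓡 dSym) ∞ g (U ×ˢ univ) := by
    intro p hp
    have h1 := (hss p.1 hp.1).comp p (contMDiff_fst (J := 𝓘(ℝ, symMatrix k)) (N := symPos k) p)
    have h2 := h1.prodMk (contMDiff_snd (I := 𝓡 dGr) (J := 𝓘(ℝ, symMatrix k)) (M := Gr k n)
      (N := symPos k) p)
    exact ((h.contMDiff_assocToSym.comp h.contMDiff_assocMk).contMDiffAt.comp p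
      h2).contMDiffWithinAt
  have hgp : ∀ p ∈ U ×ˢ (univ : Set (symPos k)), symProj (g p) = p.1 := by
    rintro ⟨P, S⟩ ⟨hP, -⟩
    exact (symProj_assocToSym _).trans (hs P hP)
  let e : Bundle.Trivialization (symPos k) (symProj (n := n) (k := k)) :=
    { toFun := f
      invFun := g
      source := symProj ⁻¹' U
      target := U ×ˢ univ
      map_source' := fun A hA => ⟨hA, mem_univ _⟩
      map_target' := fun p hp => by
        change symProj (g p) ∈ U
        rw [hgp p hp]
        exact hp.1
      left_inv' := fun A hA =>
        assocToSym_mk_eq (hs _ hA).symm (coe_toSymPos_of_posDef (hC A hA))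
      right_inv' := fun p hp => by
        refine Prod.ext (hgp p hp) ?_
        have hQ : (s p.1).1ᵀ * (s p.1).1 = 1 := (s p.1).2
        have h1 : C (g p) = p.2.1.1 := by
          change (s (symProj (g p))).1ᵀ * ((s p.1).1 * p.2.1.1 * (s p.1).1ᵀ) *
            (s (symProj (g p))).1 = _
          rw [hgp p hp]
          calc _ = (s p.1).1ᵀ * (s p.1).1 * p.2.1.1 * ((s p.1).1ᵀ * (s p.1).1) := by
                simp only [Matrix.mul_assoc]
            _ = _ := by simp [hQ]
        change toSymPos (C (g p)) = p.2
        rw [h1, toSymPos_coe]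
      open_source := hsource
      open_target := htarget
      continuousOn_toFun := hf.continuousOn
      continuousOn_invFun := hg.continuousOn
      baseSet := U
      open_baseSet := hU
      source_eq := rfl
      target_eq := rfl
      proj_toFun := fun A _ => rfl }
  exact ⟨e, grMatrix_grProj_mul_mem_orthDomain Q₀, hf, hg⟩

theorem isSmoothFiberBundle_symProj :
    IsSmoothFiberBundle (𝓡 dSym) (𝓡 dGr) 𝓘(ℝ, symMatrix k) (symPos k)
      (symProj (n := n) (k := k)) := by
  refine ⟨h.contMDiff_symProj, fun P => ?_, fun P => ?_⟩
  · obtain ⟨Q, rfl⟩ := grProj_surjective P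
    exact ⟨_, symProj_assocToSym (assocMk (Q, toSymPos 1))⟩
  · obtain ⟨Q, rfl⟩ := grProj_surjective P
    exact h.exists_trivialization_symProj Q

theorem isSmoothFiberBundle_assocProj :
    IsSmoothFiberBundle (𝓡 dM) (𝓡 dGr) 𝓘(ℝ, symMatrix k) (symPos k)
      (assocProj (n := n) (k := k)) :=
  h.isSmoothFiberBundle_symProj.comp_diffeomorph h.assocDiffeomorph symProj_assocToSym

end IsStandard

end Bundles

theorem mainTheorem1 (n k : ℕ) (hk : k ≤ n) :
    -- the standard smooth structures on `St(n,k)`, `Gr(k,n)`, `M(n,k)` and `Sym(n,k)` exist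
    (∃ (dSt dGr dM dSym : ℕ)
      (_ : ChartedSpace (EuclideanSpace ℝ (Fin dSt)) (stiefel n k))
      (_ : ChartedSpace (EuclideanSpace ℝ (Fin dGr)) (Gr k n))
      (_ : ChartedSpace (EuclideanSpace ℝ (Fin dM)) (AssocBundle n k))
      (_ : ChartedSpace (EuclideanSpace ℝ (Fin dSym)) (symRank n k)),
      IsStandard n k dSt dGr dM dSym) ∧
    -- and with respect to them:
    ∀ (dSt dGr dM dSym : ℕ)
      [ChartedSpace (EuclideanSpace ℝ (Fin dSt)) (stiefel n k)]
      [ChartedSpace (EuclideanSpace ℝ (Fin dGr)) (Gr k n)]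
      [ChartedSpace (EuclideanSpace ℝ (Fin dM)) (AssocBundle n k)]
      [ChartedSpace (EuclideanSpace ℝ (Fin dSym)) (symRank n k)],
      IsStandard n k dSt dGr dM dSym →
        -- `[Q, S] ↦ Q S Qᵀ` is a diffeomorphism and an isomorphism of fiber bundles over `Gr(k,n)`
        (∃ Φ : AssocBundle n k ≃ₘ^∞⟮𝓡 dM, 𝓡 dSym⟯ symRank n k,
          (∀ (Q : stiefel n k) (S : symPos k),
            (Φ (assocMk (Q, S)) : Matrix (Fin n) (Fin n) ℝ) =
              (Q : Matrix (Fin n) (Fin k) ℝ) * (S.1 : Matrix (Fin k) (Fin k) ℝ) *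
                (Q : Matrix (Fin n) (Fin k) ℝ)ᵀ) ∧
          IsSmoothBundleIso (𝓡 dGr) 𝓘(ℝ, symMatrix k) (symPos k) assocProj symProj Φ) ∧
        -- every fiber of either bundle is diffeomorphic to `Sym⁺(k)`
        ∀ P : Gr k n,
          IsSubmanifoldDiffeomorphicTo (𝓡 dM) {x : AssocBundle n k | assocProj x = P}
            𝓘(ℝ, symMatrix k) (symPos k) ∧
          IsSubmanifoldDiffeomorphicTo (𝓡 dSym) {A : symRank n k | symProj A = P}
            𝓘(ℝ, symMatrix k) (symPos k) := by
  refine ⟨exists_isStandard hk, fun dSt dGr dM dSym _ _ _ _ h => ⟨⟨h.assocDiffeomorph,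
    fun Q S => rfl, h.isSmoothFiberBundle_assocProj, h.isSmoothFiberBundle_symProj,
    symProj_assocToSym⟩, fun P => ?_⟩⟩
  have hne : Nonempty (symPos k) := ⟨toSymPos 1⟩
  have := h.assoc_manifold.isManifold
  have := h.assoc_manifold.t2
  have := h.assoc_manifold.secondCountable
  have := h.symRank_submanifold.manifold.isManifold
  have := h.symRank_submanifold.manifold.t2
  have := h.symRank_submanifold.manifold.secondCountable
  exact ⟨h.isSmoothFiberBundle_assocProj.isSubmanifoldDiffeomorphicTo P,
    h.isSmoothFiberBundle_symProj.isSubmanifoldDiffeomorphicTo P⟩
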